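/- Let $\alpha,\beta:\mathbb Z\to\mathbb C$ with $\alpha(n)\beta(n)\notin\{0,1\}$ for all $n\in\mathbb Z$, and put $\gamma=1-\alpha\beta$; for a lattice function $f$ write $f^{\pm}(n)=f(n\pm1)$, $f^{++}=(f^+)^+$. Let $c_{0,\pm}\in\mathbb C\setminus\{0\}$, $p_\pm\in\mathbb N_0$ with $p=p_-+p_+-1\ge 0$, and let the lattice functions $f_{\ell,\pm},g_{\ell,\pm},h_{\ell,\pm}$, $\ell\in\mathbb N_0$, be any solution (that is, any choice of summation constants) of the recursions $$g_{0,+}=\tfrac12c_{0,+},\quad f_{0,+}=-c_{0,+}\alpha^+,\quad h_{0,+}=c_{0,+}\beta,\quad g_{\ell+1,+}-g_{\ell+1,+}^-=\alpha h_{\ell,+}^-+\beta f_{\ell,+},$$ $$f_{\ell+1,+}^-=f_{\ell,+}-\alpha(g_{\ell+1,+}+g_{\ell+1,+}^-),\quad h_{\ell+1,+}=h_{\ell,+}^-+\beta(g_{\ell+1,+}+g_{\ell+1,+}^-),$$ $$g_{0,-}=\tfrac12c_{0,-},\quad f_{0,-}=c_{0,-}\alpha,\quad h_{0,-}=-c_{0,-}\beta^+,\quad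 g_{\ell+1,-}-g_{\ell+1,-}^-=\alpha h_{\ell,-}+\beta f_{\ell,-}^-,$$ $$f_{\ell+1,-}=f_{\ell,-}^-+\alpha(g_{\ell+1,-}+g_{\ell+1,-}^-),\quad h_{\ell+1,-}^-=h_{\ell,-}-\beta(g_{\ell+1,-}+g_{\ell+1,-}^-),$$ and put $f_{-1,\pm}=h_{-1,\pm}=0$. Assume the normalization $g_{p_+,+}=g_{p_-,-}$ and the stationary Ablowitz--Ladik system $$-\alpha(g_{p_+,+}+g_{p_-,-}^-)+f_{p_+-1,+}-f_{p_--1,-}^-=0,\qquad \beta(g_{p_+,+}^-+g_{p_-,-})+h_{p_+-1,+}^--h_{p_--1,-}=0 .$$ Let $$F(z)=\sum_{\ell=1}^{p_-}f_{p_--\ell,-}z^{-\ell}+\sum_{\ell=0}^{p_+-1}f_{p_+-1-\ell,+}z^{\ell},\qquad G(z)=\sum_{\ell=1}^{p_-}g_{p_--\ell,-}z^{-\ell}+\sum_{\ell=0}^{p_+}g_{p_+-\ell,+}z^{\ell},$$ $$H(z)=\sum_{\ell=0}^{p_--1}h_{p_--1-\ell,-}z^{-\ell}+\sum_{\ell=1}^{p_+}h_{p_+-\ell,+}z^{\ell},\qquad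 R=G^2-FH,$$ where $R$ does not depend on $n$. Assume $R(z)=\big(c_{0,+}/(2z^{p_-})\big)^2\prod_{m=0}^{2p+1}(z-E_m)$ with pairwise distinct $E_m$, and let $\mathcal K_p$ be the compact Riemann surface of $y^2=\prod_{m=0}^{2p+1}(z-E_m)$, with two points $P_{\infty_\pm}$ at infinity, near which $y=\mp\zeta^{-p-1}(1+O(\zeta))$, $\zeta=1/z$. Let $P_{0,\pm}=(0,\pm c_{0,-}/c_{0,+})$. Let $\mu_1(n),\dots,\mu_p(n)$ and $\nu_1(n),\dots,\nu_p(n)$ be the zeros (with multiplicity) of the polynomials $z^{p_-}F(z,n)$ and $z^{p_--1}H(z,n)$, and put $$\hat\mu_j(n)=\big(\mu_j(n),\tfrac{2}{c_{0,+}}\mu_j(n)^{p_-}G(\mu_j(n),n)\big),\qquad \hat\nu_j(n)=\big(\nu_j(n),-\tfrac{2}{c_{0,+}}\nu_j(n)^{p_-}G(\nu_j(n),n)\big).$$ For a point $Q$ let $\mathcal D_Q$ be its divisor, and let $\mathcal D_{\underline{\hat\mu}(n)}=\sum_j\mathcal D_{\hat\mu_j(n)}$, $\mathcal D_{\underline{\hat\nu}(n)}=\sum_j\mathcal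 D_{\hat\nu_j(n)}$. For $a:\mathbb Z\to\mathbb C$ let $\prod_{(n_0,n]}a$ denote $\prod_{k=n_0+1}^{n}a(k)$ if $n\ge n_0$ and $\prod_{k=n+1}^{n_0}a(k)^{-1}$ if $n<n_0$. Define $\Gamma(n,n_0)=\prod_{(n_0,n]}\gamma$ and the meromorphic functions of $P=(z,y)$ $$\phi(P,n)=\frac{(c_{0,+}/2)z^{-p_-}y+G(z,n)}{F(z,n)},\qquad \psi_1(P,n,n_0)=\prod_{(n_0,n]}\big(z+\alpha\,\phi^-(P)\big),$$ $$\psi_2(P,n,n_0)=\phi(P,n_0)\prod_{(n_0,n]}\big(z\beta\,\phi^-(P)^{-1}+1\big).$$ Then $P_{0,\pm}$ and all $\hat\mu_j(n)$, $\hat\nu_j(n)$ lie on $\mathcal K_p$, and for all $n,n_0\in\mathbb Z$ the following holds. With $\zeta=1/z$ near $P_{\infty_\pm}$ and $\zeta=z$ near $P_{0,\pm}$, as $\zeta\to0$, $$\phi=\begin{cases}\beta+\beta^-\gamma\zeta+O(\zeta^2),&P\to P_{\infty_+},\\-(\alpha^+)^{-1}\zeta^{-1}+(\alpha^+)^{-2}\alpha^{++}\gamma^++O(\zeta),&P\to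 P_{\infty_-},\\ \alpha^{-1}-\alpha^{-2}\alpha^-\gamma\zeta+O(\zeta^2),&P\to P_{0,+},\\-\beta^+\zeta-\beta^{++}\gamma^+\zeta^2+O(\zeta^3),&P\to P_{0,-},\end{cases}$$ $$\psi_1(P,n,n_0)=\begin{cases}\zeta^{n_0-n}(1+O(\zeta)),&P\to P_{\infty_+},\\ \frac{\alpha^+(n)}{\alpha^+(n_0)}\Gamma(n,n_0)+O(\zeta),&P\to P_{\infty_-},\\ \frac{\alpha(n)}{\alpha(n_0)}+O(\zeta),&P\to P_{0,+},\\ \zeta^{n-n_0}\Gamma(n,n_0)(1+O(\zeta)),&P\to P_{0,-},\end{cases}$$ $$\psi_2(P,n,n_0)=\begin{cases}\beta(n)\zeta^{n_0-n}(1+O(\zeta)),&P\to P_{\infty_+},\\-\frac{1}{\alpha^+(n_0)}\Gamma(n,n_0)\zeta^{-1}(1+O(\zeta)),&P\to P_{\infty_-},\\ \frac1{\alpha(n_0)}+O(\zeta),&P\to P_{0,+},\\-\beta^+(n)\Gamma(n,n_0)\zeta^{n+1-n_0}(1+O(\zeta)),&P\to P_{0,-}.\end{cases}$$ The divisors of $\psi_1,\psi_2$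 on $\mathcal K_p$ are $$(\psi_1(\cdot,n,n_0))=\mathcal D_{\underline{\hat\mu}(n)}-\mathcal D_{\underline{\hat\mu}(n_0)}+(n-n_0)(\mathcal D_{P_{0,-}}-\mathcal D_{P_{\infty_+}}),$$ $$(\psi_2(\cdot,n,n_0))=\mathcal D_{\underline{\hat\nu}(n)}-\mathcal D_{\underline{\hat\mu}(n_0)}+(n-n_0)(\mathcal D_{P_{0,-}}-\mathcal D_{P_{\infty_+}})+\mathcal D_{P_{0,-}}-\mathcal D_{P_{\infty_-}}.$$ -/

import Mathlib

open Filter Topology Asymptotics Polynomial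

noncomputable section

/-- Raw data: lattice functions `α, β`, leading constants `c_{0,-}, c_{0,+}`, the index
`(p_-, p_+)`, and the coefficient sequences `f_{ℓ,±}(n), g_{ℓ,±}(n), h_{ℓ,±}(n)`
(`m` stands for the subscript `-`, `p` for the subscript `+`). The laws are imposed below. -/
structure ALData where
  α : ℤ → ℂ
  β : ℤ → ℂ
  cm : ℂ
  cp : ℂ
  pm : ℕ
  pp : ℕ
  fm : ℕ → ℤ → ℂ
  gm : ℕ → ℤ → ℂ
  hm : ℕ → ℤ → ℂ
  fp : ℕ → ℤ → ℂ
  gp : ℕ → ℤ → ℂ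
  hp : ℕ → ℤ → ℂ

/-- `prevCoeff a k = a_{k-1}`, with the convention `a_{-1} = 0`. -/
def prevCoeff (a : ℕ → ℤ → ℂ) : ℕ → ℤ → ℂ
  | 0 => fun _ => 0
  | k + 1 => a k

/-- `∏_{k = n₀+1}^{n} a k` for `n ≥ n₀` and `∏_{k = n+1}^{n₀} (a k)⁻¹` for `n < n₀`. -/
def latticeProd (a : ℤ → ℂ) (n n₀ : ℤ) : ℂ :=
  if n₀ ≤ n then ∏ k ∈ Finset.Ioc n₀ n, a k else ∏ k ∈ Finset.Ioc n n₀, (a k)⁻¹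

/-- Points `(z, y)` of `ℂ²`, together with two points at infinity. -/
inductive CurvePt where
  | affine (z y : ℂ) : CurvePt
  | infPlus : CurvePt
  | infMinus : CurvePt

namespace CurvePt

/-- The coordinate `z` (not used at the points at infinity). -/
def z : CurvePt → ℂ
  | affine z _ => z
  | infPlus => 0
  | infMinus => 0

/-- The coordinate `y` (not used at the points at infinity). -/
def y : CurvePt → ℂ
  | affine _ y => y
  | infPlus => 0
  | infMinus => 0

end CurvePt

/-- The compactified hyperelliptic curve `y² = ∏_{m=0}^{2p+1} (z - E_m)`. -/
def hyperCurve {p : ℕ} (E : Fin (2 * p + 2) → ℂ) : Set CurvePt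
  | .affine z y => y ^ 2 = ∏ m, (z - E m)
  | .infPlus => True
  | .infMinus => True

open Classical in
/-- The inverse `ζ ↦ P(ζ)`, `P(0) = Q`, of the standard local coordinate of the nonsingular
curve at `Q`:
* at `(z₀, y₀)` with `y₀ ≠ 0`: `ζ = z - z₀`, with the branch of `y` that equals `y₀` at `z₀`;
* at a branch point `(E_{m₀}, 0)`: `ζ = (z - E_{m₀})^{1/2}`;
* at `P_{∞±}`: `ζ = 1/z`, where `y = ∓ ζ^{-p-1} (1 + O(ζ))`. -/
def localParam {p : ℕ} (E : Fin (2 * p + 2) → ℂ) : CurvePt → ℂ → CurvePt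
  | .affine z₀ y₀, ζ =>
      if y₀ = 0 then
        .affine (z₀ + ζ ^ 2)
          (ζ * ((∏ m ∈ Finset.univ.filter (fun m => E m ≠ z₀), (z₀ - E m)) ^ (1 / 2 : ℂ)
            * ((∏ m ∈ Finset.univ.filter (fun m => E m ≠ z₀), (z₀ + ζ ^ 2 - E m))
              / ∏ m ∈ Finset.univ.filter (fun m => E m ≠ z₀), (z₀ - E m)) ^ (1 / 2 : ℂ)))
      else
        .affine (z₀ + ζ)
          (y₀ * ((∏ m, (z₀ + ζ - E m)) / ∏ m, (z₀ - E m)) ^ (1 / 2 : ℂ))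
  | .infPlus, ζ =>
      if ζ = 0 then .infPlus
      else .affine ζ⁻¹ (-((ζ ^ (p + 1))⁻¹ * (∏ m, (1 - E m * ζ)) ^ (1 / 2 : ℂ)))
  | .infMinus, ζ =>
      if ζ = 0 then .infMinus
      else .affine ζ⁻¹ ((ζ ^ (p + 1))⁻¹ * (∏ m, (1 - E m * ζ)) ^ (1 / 2 : ℂ))

/-- The parametrization at a point of the curve starts at that point. -/
theorem localParam_zero {p : ℕ} (E : Fin (2 * p + 2) → ℂ) {Q : CurvePt}
    (hQ : Q ∈ hyperCurve E) : localParam E Q 0 = Q := by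
  cases Q with
  | affine z₀ y₀ =>
    have hQ' : y₀ ^ 2 = ∏ m, (z₀ - E m) := hQ
    by_cases h : y₀ = 0
    · simp [localParam, h]
    · have h0 : ∏ m, (z₀ - E m) ≠ 0 := by rw [← hQ']; exact pow_ne_zero 2 h
      simp [localParam, h, div_self h0]
  | infPlus => simp [localParam]
  | infMinus => simp [localParam]

/-- Every value of the parametrization at a point of the curve lies on the curve. -/
theorem localParam_mem {p : ℕ} (E : Fin (2 * p + 2) → ℂ)
    (hE : Function.Injective E) {Q : CurvePt} (hQ : Q ∈ hyperCurve E)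
    (ζ : ℂ) : localParam E Q ζ ∈ hyperCurve E := by
  classical
  have sq : ∀ w : ℂ, (w ^ (1 / 2 : ℂ)) ^ 2 = w := fun w => by
    rw [one_div]; exact Complex.cpow_nat_inv_pow w two_ne_zero
  have inf : ζ ≠ 0 → ∏ m, (ζ⁻¹ - E m) = ((ζ ^ (p + 1))⁻¹) ^ 2 * ∏ m, (1 - E m * ζ) := fun h => by
    have : ∀ m, ζ⁻¹ - E m = ζ⁻¹ * (1 - E m * ζ) := fun m => by field_simp
    simp only [this, Finset.prod_mul_distrib, Finset.prod_const, Finset.card_univ,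
      Fintype.card_fin]
    congr 1
    rw [inv_pow, inv_pow, ← pow_mul]
    congr 2
    ring
  cases Q with
  | affine z₀ y₀ =>
    have hQ' : y₀ ^ 2 = ∏ m, (z₀ - E m) := hQ
    by_cases h : y₀ = 0
    · have hz : ∏ m, (z₀ - E m) = 0 := by rw [← hQ', h]; simp
      obtain ⟨m₀, -, hm₀⟩ := Finset.prod_eq_zero_iff.1 hz
      have hm : E m₀ = z₀ := (sub_eq_zero.1 hm₀).symm
      have hf : Finset.univ.filter (fun m => E m ≠ z₀) = Finset.univ.erase m₀ := by
        ext m; simp [← hm, hE.eq_iff]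
      have h0 : ∏ m ∈ Finset.univ.erase m₀, (z₀ - E m) ≠ 0 :=
        Finset.prod_ne_zero_iff.2 fun m hmm => by
          rw [← hm]; exact sub_ne_zero.2 fun e => (Finset.ne_of_mem_erase hmm) (hE e).symm
      simp only [localParam, h, if_true]
      change (ζ * (_ * _)) ^ 2 = _
      rw [mul_pow, mul_pow, sq, sq, hf, mul_div_cancel₀ _ h0,
        ← Finset.mul_prod_erase _ _ (Finset.mem_univ m₀), hm]
      ring
    · have h0 : ∏ m, (z₀ - E m) ≠ 0 := by rw [← hQ']; exact pow_ne_zero 2 h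
      simp only [localParam, h, if_false]
      change (y₀ * _) ^ 2 = _
      rw [mul_pow, sq, hQ', mul_div_cancel₀ _ h0]
  | infPlus =>
    by_cases h : ζ = 0
    · simp only [localParam, h, if_true]; trivial
    · simp only [localParam, h, if_false]
      change (-(_ * _)) ^ 2 = _
      rw [neg_sq, mul_pow, sq, inf h]
  | infMinus =>
    by_cases h : ζ = 0
    · simp only [localParam, h, if_true]; trivial
    · simp only [localParam, h, if_false]
      change (_ * _) ^ 2 = _
      rw [mul_pow, sq, inf h]

/-- The filter of punctured neighbourhoods of `Q` on the curve: `P → Q`, `P ≠ Q`. -/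
def towards {p : ℕ} (E : Fin (2 * p + 2) → ℂ) (Q : CurvePt) : Filter CurvePt :=
  map (localParam E Q) (𝓝[≠] 0)

/-- `F` is a nonzero meromorphic function on the curve and its divisor `(F)` is `D`: the order
of `F` at each point `Q` of the curve, in the local coordinate at `Q`, is `D Q`. Divisors are
finitely supported integer-valued functions, supported on the curve. -/
def HasDivisor {p : ℕ} (E : Fin (2 * p + 2) → ℂ) (F : CurvePt → ℂ) (D : CurvePt →₀ ℤ) : Prop :=
  (∀ Q ∈ D.support, Q ∈ hyperCurve E) ∧
  ∀ Q ∈ hyperCurve E,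
    MeromorphicAt (fun ζ => F (localParam E Q ζ)) 0 ∧
    meromorphicOrderAt (fun ζ => F (localParam E Q ζ)) 0 = ((D Q : ℤ) : WithTop ℤ)

/-- The divisor `D_Q` of a point. -/
def ptDiv (Q : CurvePt) : CurvePt →₀ ℤ := Finsupp.single Q 1

namespace ALData

variable (S : ALData)

/-- `γ = 1 - α β`. -/
def γ (n : ℤ) : ℂ := 1 - S.α n * S.β n

/-- `Γ(n, n₀)`. -/
def Gam (n n₀ : ℤ) : ℂ := latticeProd S.γ n n₀

/-- The recursion for `f_{ℓ,+}, g_{ℓ,+}, h_{ℓ,+}`. Each solution of the difference equation for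
`g_{ℓ+1,+}` corresponds to one choice of the summation constant `c_{ℓ+1,+}`. -/
structure RecursionPlus : Prop where
  g_zero : ∀ n, S.gp 0 n = S.cp / 2
  f_zero : ∀ n, S.fp 0 n = -S.cp * S.α (n + 1)
  h_zero : ∀ n, S.hp 0 n = S.cp * S.β n
  g_succ : ∀ l n, S.gp (l + 1) n - S.gp (l + 1) (n - 1)
    = S.α n * S.hp l (n - 1) + S.β n * S.fp l n
  f_succ : ∀ l n, S.fp (l + 1) (n - 1)
    = S.fp l n - S.α n * (S.gp (l + 1) n + S.gp (l + 1) (n - 1))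
  h_succ : ∀ l n, S.hp (l + 1) n
    = S.hp l (n - 1) + S.β n * (S.gp (l + 1) n + S.gp (l + 1) (n - 1))

/-- The recursion for `f_{ℓ,-}, g_{ℓ,-}, h_{ℓ,-}`. -/
structure RecursionMinus : Prop where
  g_zero : ∀ n, S.gm 0 n = S.cm / 2
  f_zero : ∀ n, S.fm 0 n = S.cm * S.α n
  h_zero : ∀ n, S.hm 0 n = -S.cm * S.β (n + 1)
  g_succ : ∀ l n, S.gm (l + 1) n - S.gm (l + 1) (n - 1)
    = S.α n * S.hm l n + S.β n * S.fm l (n - 1)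
  f_succ : ∀ l n, S.fm (l + 1) n
    = S.fm l (n - 1) + S.α n * (S.gm (l + 1) n + S.gm (l + 1) (n - 1))
  h_succ : ∀ l n, S.hm (l + 1) (n - 1)
    = S.hm l n - S.β n * (S.gm (l + 1) n + S.gm (l + 1) (n - 1))

/-- The stationary Ablowitz-Ladik system of index `(p_-, p_+)`. -/
def StationaryAL : Prop :=
  ∀ n, -S.α n * (S.gp S.pp n + S.gm S.pm (n - 1))
      + prevCoeff S.fp S.pp n - prevCoeff S.fm S.pm (n - 1) = 0 ∧
    S.β n * (S.gp S.pp (n - 1) + S.gm S.pm n)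
      + prevCoeff S.hp S.pp (n - 1) - prevCoeff S.hm S.pm n = 0

/-- The Laurent polynomial `F_p(z, n)`. -/
def F (z : ℂ) (n : ℤ) : ℂ :=
  ∑ l ∈ Finset.Icc 1 S.pm, S.fm (S.pm - l) n * z ^ (-(l : ℤ))
    + ∑ l ∈ Finset.range S.pp, S.fp (S.pp - 1 - l) n * z ^ l

/-- The Laurent polynomial `G_p(z, n)`. -/
def G (z : ℂ) (n : ℤ) : ℂ :=
  ∑ l ∈ Finset.Icc 1 S.pm, S.gm (S.pm - l) n * z ^ (-(l : ℤ))
    + ∑ l ∈ Finset.range (S.pp + 1), S.gp (S.pp - l) n * z ^ l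

/-- The Laurent polynomial `H_p(z, n)`. -/
def H (z : ℂ) (n : ℤ) : ℂ :=
  ∑ l ∈ Finset.range S.pm, S.hm (S.pm - 1 - l) n * z ^ (-(l : ℤ))
    + ∑ l ∈ Finset.Icc 1 S.pp, S.hp (S.pp - l) n * z ^ l

/-- `R_p = G_p² - F_p H_p`. -/
def R (z : ℂ) (n : ℤ) : ℂ := S.G z n ^ 2 - S.F z n * S.H z n

/-- The polynomial `z^{p_-} F_p(z, n)`. -/
def polyF (n : ℤ) : ℂ[X] :=
  ∑ l ∈ Finset.range S.pm, C (S.fm l n) * X ^ l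
    + ∑ l ∈ Finset.range S.pp, C (S.fp (S.pp - 1 - l) n) * X ^ (S.pm + l)

/-- The polynomial `z^{p_- - 1} H_p(z, n)`. -/
def polyH (n : ℤ) : ℂ[X] :=
  ∑ l ∈ Finset.range S.pm, C (S.hm l n) * X ^ l
    + ∑ l ∈ Finset.range S.pp, C (S.hp (S.pp - 1 - l) n) * X ^ (S.pm + l)

theorem polyF_eval (n : ℤ) {z : ℂ} (hz : z ≠ 0) :
    (S.polyF n).eval z = z ^ S.pm * S.F z n := by
  simp only [polyF, F, eval_add, eval_finsetSum, eval_mul, eval_C, eval_pow, eval_X, mul_add,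
    Finset.mul_sum]
  congr 1
  · refine Finset.sum_bij' (fun l _ => S.pm - l) (fun l _ => S.pm - l) ?_ ?_ ?_ ?_ ?_
    · intro l hl; simp at hl ⊢; omega
    · intro l hl; simp at hl ⊢; omega
    · intro l hl; simp at hl ⊢; omega
    · intro l hl; simp at hl ⊢; omega
    · intro l hl
      simp only [Finset.mem_range] at hl
      have h1 : S.pm - (S.pm - l) = l := by omega
      have h2 : z ^ S.pm = z ^ l * z ^ (S.pm - l) := by rw [← pow_add]; congr 1; omega
      rw [h1, h2, zpow_neg, zpow_natCast]
      field_simp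
  · refine Finset.sum_congr rfl fun l _ => ?_
    rw [pow_add]; ring

theorem polyH_eval (n : ℤ) {z : ℂ} (hz : z ≠ 0) :
    (S.polyH n).eval z = z ^ ((S.pm : ℤ) - 1) * S.H z n := by
  simp only [polyH, H, eval_add, eval_finsetSum, eval_mul, eval_C, eval_pow, eval_X, mul_add,
    Finset.mul_sum]
  congr 1
  · refine Finset.sum_bij' (fun l _ => S.pm - 1 - l) (fun l _ => S.pm - 1 - l) ?_ ?_ ?_ ?_ ?_
    · intro l hl; simp at hl ⊢; omega
    · intro l hl; simp at hl ⊢; omega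
    · intro l hl; simp at hl ⊢; omega
    · intro l hl; simp at hl ⊢; omega
    · intro l hl
      simp only [Finset.mem_range] at hl
      have h1 : S.pm - 1 - (S.pm - 1 - l) = l := by omega
      rw [h1, mul_left_comm, ← zpow_add₀ hz, ← zpow_natCast]
      congr 2
      omega
  · refine Finset.sum_bij' (fun l _ => l + 1) (fun l _ => l - 1) ?_ ?_ ?_ ?_ ?_
    · intro l hl; simp at hl ⊢; omega
    · intro l hl; simp at hl ⊢; omega
    · intro l hl; simp
    · intro l hl; simp at hl ⊢; omega
    · intro l hl
      have h1 : S.pp - (l + 1) = S.pp - 1 - l := by omega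
      rw [h1, mul_left_comm, ← zpow_natCast z (l + 1), ← zpow_add₀ hz, ← zpow_natCast]
      congr 2
      push_cast
      ring

/-- The zeros `μ_1(n), …, μ_p(n)` of `z^{p_-} F_p(z, n)`, with multiplicity. -/
def mu (n : ℤ) : Multiset ℂ := (S.polyF n).roots

/-- The zeros `ν_1(n), …, ν_p(n)` of `z^{p_- - 1} H_p(z, n)`, with multiplicity. -/
def nu (n : ℤ) : Multiset ℂ := (S.polyH n).roots

/-- The lift `μ ↦ μ̂ = (μ, (2/c_{0,+}) μ^{p_-} G_p(μ, n))`. -/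
def muHat (n : ℤ) (μ : ℂ) : CurvePt := .affine μ (2 / S.cp * μ ^ S.pm * S.G μ n)

/-- The lift `ν ↦ ν̂ = (ν, -(2/c_{0,+}) ν^{p_-} G_p(ν, n))`. -/
def nuHat (n : ℤ) (ν : ℂ) : CurvePt := .affine ν (-(2 / S.cp * ν ^ S.pm * S.G ν n))

/-- The divisor of `μ̂_1(n), …, μ̂_p(n)`. -/
def divMu (n : ℤ) : CurvePt →₀ ℤ := ((S.mu n).map fun μ => ptDiv (S.muHat n μ)).sum

/-- The divisor of `ν̂_1(n), …, ν̂_p(n)`. -/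
def divNu (n : ℤ) : CurvePt →₀ ℤ := ((S.nu n).map fun ν => ptDiv (S.nuHat n ν)).sum

/-- `P_{0,+} = (0, c_{0,-}/c_{0,+})`. -/
def zeroPlus : CurvePt := .affine 0 (S.cm / S.cp)

/-- `P_{0,-} = (0, -c_{0,-}/c_{0,+})`. -/
def zeroMinus : CurvePt := .affine 0 (-(S.cm / S.cp))

/-- The function `φ(P, n)`. -/
def phi (P : CurvePt) (n : ℤ) : ℂ :=
  (S.cp / 2 * P.z ^ (-(S.pm : ℤ)) * P.y + S.G P.z n) / S.F P.z n

/-- The first component of the Baker-Akhiezer vector. -/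
def psi1 (P : CurvePt) (n n₀ : ℤ) : ℂ :=
  latticeProd (fun k => P.z + S.α k * S.phi P (k - 1)) n n₀

/-- The second component of the Baker-Akhiezer vector. -/
def psi2 (P : CurvePt) (n n₀ : ℤ) : ℂ :=
  S.phi P n₀ * latticeProd (fun k => P.z * S.β k * (S.phi P (k - 1))⁻¹ + 1) n n₀

end ALData

end

/-! Write `F`, `G`, `H` also for the polynomials `polyF`, `polyG`, `polyH`, a superscript `⁻` for
the shift `n ↦ n - 1`, and `c = c_{0,+}/2`. Both recursions and the stationary system amount to
three polynomial identities: `F = zF⁻ + α(G + G⁻)`, `zH = H⁻ + β(G + G⁻)` and `G - G⁻ = z(βF⁻ + αH)`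
(`polyF_shift`, `polyH_shift`, `polyG_shift`). They make `G² - zFH` independent of `n`, equal to `c²
∏ (z - E_m)`. On the curve this gives two expressions `φ = (cy + G)/F = zH/(G - cy)` and the
Riccati-type equation `φ(z + αφ⁻) = zβ + φ⁻` (`riccati`).

Expansions: at each of the four special points one of the two expressions for `φ` has no
cancellation between leading terms, and so yields the leading term of `φ`; the Riccati equation
turns it into the next one. The factors `z + αφ⁻` of `ψ₁` then have known leading terms and their
product telescopes. Dividing the Riccati equation by `φ⁻` and telescoping gives `ψ₂ = φψ₁`
(`eventually_psi2_eq`), which reduces every claim on `ψ₂` to `ψ₁` and `φ`.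

Divisors: away from the special points `φ` and `z + αφ⁻` are, up to constants, of the form `(cy +
g(z))/q(z)`, where `g² - c² ∏ (z - E_m)` factors into known polynomials: `zFH` for `φ`, and `γα⁻²
zF⁻F` for `z + αφ⁻`. The order of such a numerator comes from multiplication by its conjugate `g -
cy`, branch points being treated directly (`hasOrder_sqrt_add`). The zeros of the denominator are
shared between the two sheets (`ramification_mul_F`), and the share on the wrong sheet cancels
against the numerator. So `z + αφ⁻` has divisor `D_μ(n) - D_μ(n-1) + P_{0,-} - P_{∞+}`, which again
telescopes. -/

noncomputable section

/-! ### Leading terms of germs at the origin -/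

/-- `f ζ = ζ ^ k * (c + O(ζ))` near `0`, with an analytic second factor. -/
def HasLeadingTerm (f : ℂ → ℂ) (k : ℤ) (c : ℂ) : Prop :=
  ∃ g : ℂ → ℂ, AnalyticAt ℂ g 0 ∧ g 0 = c ∧ ∀ᶠ ζ in 𝓝[≠] (0 : ℂ), f ζ = ζ ^ k * g ζ

theorem eventually_ne_zero_punctured : ∀ᶠ ζ : ℂ in 𝓝[≠] 0, ζ ≠ 0 :=
  eventually_mem_nhdsWithin

namespace HasLeadingTerm

variable {f f₁ f₂ : ℂ → ℂ} {k k₁ k₂ : ℤ} {c c₁ c₂ : ℂ}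

theorem of_analyticAt (hf : AnalyticAt ℂ f 0) : HasLeadingTerm f 0 (f 0) :=
  ⟨f, hf, rfl, by simp⟩

theorem const (c : ℂ) : HasLeadingTerm (fun _ => c) 0 c := of_analyticAt analyticAt_const

theorem zpow_id (k : ℤ) : HasLeadingTerm (fun ζ => ζ ^ k) k 1 :=
  ⟨fun _ => 1, analyticAt_const, rfl, by simp⟩

theorem congr (h : HasLeadingTerm f₁ k c) (e : ∀ᶠ ζ in 𝓝[≠] (0 : ℂ), f₂ ζ = f₁ ζ) :
    HasLeadingTerm f₂ k c := by
  obtain ⟨g, hg, hc, hf⟩ := h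
  refine ⟨g, hg, hc, ?_⟩
  filter_upwards [hf, e] with ζ h1 h2
  rw [h2, h1]

theorem mul (h₁ : HasLeadingTerm f₁ k₁ c₁) (h₂ : HasLeadingTerm f₂ k₂ c₂) :
    HasLeadingTerm (fun ζ => f₁ ζ * f₂ ζ) (k₁ + k₂) (c₁ * c₂) := by
  obtain ⟨g₁, hg₁, rfl, hf₁⟩ := h₁
  obtain ⟨g₂, hg₂, rfl, hf₂⟩ := h₂
  refine ⟨fun ζ => g₁ ζ * g₂ ζ, hg₁.mul hg₂, rfl, ?_⟩
  filter_upwards [hf₁, hf₂, eventually_ne_zero_punctured] with ζ h1 h2 h0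
  rw [h1, h2, zpow_add₀ h0]
  ring

theorem const_mul (a : ℂ) (h : HasLeadingTerm f k c) :
    HasLeadingTerm (fun ζ => a * f ζ) k (a * c) := by
  simpa using (const a).mul h

/-- No condition on `c₁ + c₂` is needed because a leading coefficient may be `0`. Nonvanishing
enters only where a germ is inverted or its order is read off. -/
theorem add (h₁ : HasLeadingTerm f₁ k c₁) (h₂ : HasLeadingTerm f₂ k c₂) :
    HasLeadingTerm (fun ζ => f₁ ζ + f₂ ζ) k (c₁ + c₂) := by
  obtain ⟨g₁, hg₁, rfl, hf₁⟩ := h₁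
  obtain ⟨g₂, hg₂, rfl, hf₂⟩ := h₂
  refine ⟨fun ζ => g₁ ζ + g₂ ζ, hg₁.add hg₂, rfl, ?_⟩
  filter_upwards [hf₁, hf₂] with ζ h1 h2
  rw [h1, h2]
  ring

theorem neg (h : HasLeadingTerm f k c) : HasLeadingTerm (fun ζ => -f ζ) k (-c) := by
  simpa using h.const_mul (-1)

theorem sub (h₁ : HasLeadingTerm f₁ k c₁) (h₂ : HasLeadingTerm f₂ k c₂) :
    HasLeadingTerm (fun ζ => f₁ ζ - f₂ ζ) k (c₁ - c₂) := by
  simpa [sub_eq_add_neg] using h₁.add h₂.neg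

/-- A germ of higher order has leading coefficient `0` at every lower order. -/
theorem of_lt (h : HasLeadingTerm f k₁ c) (hk : k < k₁) : HasLeadingTerm f k 0 := by
  obtain ⟨g, hg, -, hf⟩ := h
  obtain ⟨m, rfl⟩ : ∃ m : ℕ, k₁ = k + (m + 1 : ℕ) := ⟨(k₁ - k - 1).toNat, by omega⟩
  refine ⟨fun ζ => ζ ^ (m + 1) * g ζ, (analyticAt_id.pow _).mul hg, by simp, ?_⟩
  filter_upwards [hf, eventually_ne_zero_punctured] with ζ h1 h0
  rw [h1, zpow_add₀ h0, zpow_natCast, mul_assoc]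

theorem eventually_ne_zero (h : HasLeadingTerm f k c) (hc : c ≠ 0) :
    ∀ᶠ ζ in 𝓝[≠] (0 : ℂ), f ζ ≠ 0 := by
  obtain ⟨g, hg, rfl, hf⟩ := h
  filter_upwards [hf, eventually_ne_zero_punctured,
    (hg.continuousAt.eventually_ne hc).filter_mono nhdsWithin_le_nhds] with ζ h1 h0 h2
  rw [h1]
  exact mul_ne_zero (zpow_ne_zero _ h0) h2

theorem inv (h : HasLeadingTerm f k c) (hc : c ≠ 0) :
    HasLeadingTerm (fun ζ => (f ζ)⁻¹) (-k) c⁻¹ := by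
  obtain ⟨g, hg, rfl, hf⟩ := h
  refine ⟨fun ζ => (g ζ)⁻¹, hg.inv hc, rfl, ?_⟩
  filter_upwards [hf] with ζ h1
  rw [h1, mul_inv, zpow_neg]

theorem div (h₁ : HasLeadingTerm f₁ k₁ c₁) (h₂ : HasLeadingTerm f₂ k₂ c₂) (hc : c₂ ≠ 0) :
    HasLeadingTerm (fun ζ => f₁ ζ / f₂ ζ) (k₁ - k₂) (c₁ / c₂) := by
  simpa [div_eq_mul_inv, sub_eq_add_neg] using h₁.mul (h₂.inv hc)

theorem sub_isBigO (h : HasLeadingTerm f k c) :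
    (fun ζ => f ζ - c * ζ ^ k) =O[𝓝[≠] (0 : ℂ)] fun ζ => ζ ^ (k + 1) := by
  obtain ⟨g, hg, rfl, hf⟩ := h
  have h1 : (fun ζ => g ζ - g 0) =O[𝓝[≠] (0 : ℂ)] fun ζ => ζ := by
    simpa using (hg.differentiableAt.isBigO_sub).mono (nhdsWithin_le_nhds (s := {0}ᶜ))
  refine ((isBigO_refl (fun ζ : ℂ => ζ ^ k) (𝓝[≠] 0)).mul h1).congr' ?_ ?_
  · filter_upwards [hf] with ζ h1
    rw [h1]
    ring
  · filter_upwards [eventually_ne_zero_punctured] with ζ h0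
    rw [zpow_add_one₀ h0]

theorem meromorphicAt (h : HasLeadingTerm f k c) : MeromorphicAt f 0 := by
  obtain ⟨g, hg, -, hf⟩ := h
  have : MeromorphicAt (fun ζ : ℂ => ζ ^ k * g ζ) 0 :=
    ((MeromorphicAt.id 0).zpow k).mul hg.meromorphicAt
  exact this.congr (hf.mono fun ζ h => h.symm)

theorem meromorphicOrderAt_eq (h : HasLeadingTerm f k c) (hc : c ≠ 0) :
    meromorphicOrderAt f 0 = (k : WithTop ℤ) := by
  rw [meromorphicOrderAt_eq_int_iff h.meromorphicAt]
  obtain ⟨g, hg, rfl, hf⟩ := h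
  exact ⟨g, hg, hc, by simpa using hf⟩

end HasLeadingTerm

/-! ### Products over lattice intervals -/

theorem latticeProd_self (a : ℤ → ℂ) (n : ℤ) : latticeProd a n n = 1 := by simp [latticeProd]

theorem latticeProd_succ (a : ℤ → ℂ) {n n₀ : ℤ} (h : n₀ ≤ n) :
    latticeProd a (n + 1) n₀ = latticeProd a n n₀ * a (n + 1) := by
  have : Finset.Ioc n₀ (n + 1) = insert (n + 1) (Finset.Ioc n₀ n) := by
    ext k
    simp only [Finset.mem_Ioc, Finset.mem_insert]
    omega
  rw [latticeProd, latticeProd, if_pos h, if_pos (by omega), this,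
    Finset.prod_insert (by simp), mul_comm]

theorem latticeProd_symm (a : ℤ → ℂ) (n n₀ : ℤ) :
    latticeProd a n n₀ = (latticeProd a n₀ n)⁻¹ := by
  rcases lt_trichotomy n n₀ with h | rfl | h
  · simp [latticeProd, h.le, h.not_ge, Finset.prod_inv_distrib]
  · simp [latticeProd_self]
  · simp [latticeProd, h.le, h.not_ge, Finset.prod_inv_distrib]

theorem latticeProd_ne_zero {a : ℤ → ℂ} (ha : ∀ k, a k ≠ 0) (n n₀ : ℤ) :
    latticeProd a n n₀ ≠ 0 := by
  rw [latticeProd]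
  split_ifs
  · exact Finset.prod_ne_zero_iff.2 fun k _ => ha k
  · exact Finset.prod_ne_zero_iff.2 fun k _ => inv_ne_zero (ha k)

theorem latticeProd_one (n n₀ : ℤ) : latticeProd (fun _ => 1) n n₀ = 1 := by
  simp [latticeProd]

theorem latticeProd_mul (a b : ℤ → ℂ) (n n₀ : ℤ) :
    latticeProd (fun k => a k * b k) n n₀ = latticeProd a n n₀ * latticeProd b n n₀ := by
  simp only [latticeProd]
  split_ifs
  · exact Finset.prod_mul_distrib
  · simp only [mul_inv, Finset.prod_mul_distrib]

/-- Nonvanishing is asked only between `n₀` and `n`: values of `φ` at a fixed point near `Q` are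
controlled for finitely many lattice sites at a time. -/
theorem latticeProd_telescope {u : ℤ → ℂ} {n n₀ : ℤ} (hu : ∀ k ∈ Finset.uIcc n₀ n, u k ≠ 0) :
    latticeProd (fun k => u k / u (k - 1)) n n₀ = u n / u n₀ := by
  have key : ∀ n n₀ : ℤ, n₀ ≤ n → (∀ k, n₀ ≤ k → k ≤ n → u k ≠ 0) →
      latticeProd (fun k => u k / u (k - 1)) n n₀ = u n / u n₀ := by
    intro n n₀ h
    induction n, h using Int.leInduction with
    | base =>
      intro hu
      rw [latticeProd_self, div_self (hu _ le_rfl le_rfl)]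
    | succ n h ih =>
      intro hu
      have := hu n h (by omega)
      rw [latticeProd_succ _ h, ih fun k h1 h2 => hu k h1 (by omega), add_sub_cancel_right]
      field_simp
  rcases le_total n₀ n with h | h
  · exact key n n₀ h fun k h1 h2 => hu k (by simp [Finset.uIcc_of_le h, h1, h2])
  · rw [latticeProd_symm, key n₀ n h fun k h1 h2 => hu k (by simp [Finset.uIcc_of_ge h, h1, h2]),
      inv_div]

/-- Products of finitely many values depend only on finitely many equalities. -/
theorem eventually_latticeProd_congr {ι : Type*} {l : Filter ι} {a b : ℤ → ι → ℂ}
    (h : ∀ k, ∀ᶠ x in l, a k x = b k x) (n n₀ : ℤ) :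
    ∀ᶠ x in l, latticeProd (fun k => a k x) n n₀ = latticeProd (fun k => b k x) n n₀ := by
  have h1 : ∀ s : Finset ℤ, ∀ᶠ x in l, ∀ k ∈ s, a k x = b k x := fun s =>
    (Filter.eventually_all_finset s).2 fun k _ => h k
  filter_upwards [h1 (Finset.Ioc n₀ n), h1 (Finset.Ioc n n₀)] with x hx hy
  simp only [latticeProd]
  split_ifs
  · exact Finset.prod_congr rfl hx
  · exact Finset.prod_congr rfl fun k hk => by rw [hy k hk]

/-- Prescribing the orders as differences of `d` lets them telescope. The case `n < n₀` is the
reciprocal of the case with endpoints exchanged, which is where `c k ≠ 0` is used. -/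
theorem HasLeadingTerm.latticeProd {a : ℤ → ℂ → ℂ} {d : ℤ → ℤ} {c : ℤ → ℂ}
    (ha : ∀ k, HasLeadingTerm (a k) (d k - d (k - 1)) (c k)) (hc : ∀ k, c k ≠ 0) (n n₀ : ℤ) :
    HasLeadingTerm (fun ζ => latticeProd (fun k => a k ζ) n n₀) (d n - d n₀)
      (latticeProd c n n₀) := by
  have key : ∀ n n₀ : ℤ, n₀ ≤ n → HasLeadingTerm (fun ζ => _root_.latticeProd (fun k => a k ζ) n n₀)
      (d n - d n₀) (_root_.latticeProd c n n₀) := by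
    intro n n₀ h
    induction n, h using Int.leInduction with
    | base => simpa [latticeProd_self] using HasLeadingTerm.const 1
    | succ n h ih =>
      simp only [latticeProd_succ _ h]
      have := ih.mul (ha (n + 1))
      rwa [add_sub_cancel_right, show d n - d n₀ + (d (n + 1) - d n) = d (n + 1) - d n₀ by ring]
        at this
  rcases le_total n₀ n with h | h
  · exact key n n₀ h
  · rw [latticeProd_symm]
    simp only [latticeProd_symm _ n n₀]
    have := (key n₀ n h).inv (latticeProd_ne_zero hc _ _)
    rwa [neg_sub] at this

namespace ALData

variable (S : ALData)

/-! ### The polynomials `z^{p_-} F`, `z^{p_-} G`, `z^{p_- - 1} H` and their shift relations -/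

/-- The polynomial `z^{p_-} G_p(z, n)`. -/
def polyG (n : ℤ) : ℂ[X] :=
  ∑ l ∈ Finset.range S.pm, C (S.gm l n) * X ^ l
    + ∑ l ∈ Finset.range (S.pp + 1), C (S.gp (S.pp - l) n) * X ^ (S.pm + l)

theorem polyG_eval (n : ℤ) {z : ℂ} (hz : z ≠ 0) :
    (S.polyG n).eval z = z ^ S.pm * S.G z n := by
  simp only [polyG, G, eval_add, eval_finsetSum, eval_mul, eval_C, eval_pow, eval_X, mul_add,
    Finset.mul_sum]
  congr 1
  · refine Finset.sum_bij' (fun l _ => S.pm - l) (fun l _ => S.pm - l) ?_ ?_ ?_ ?_ ?_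
    · intro l hl; simp at hl ⊢; omega
    · intro l hl; simp at hl ⊢; omega
    · intro l hl; simp at hl ⊢; omega
    · intro l hl; simp at hl ⊢; omega
    · intro l hl
      simp only [Finset.mem_range] at hl
      have h1 : S.pm - (S.pm - l) = l := by omega
      have h2 : z ^ S.pm = z ^ l * z ^ (S.pm - l) := by rw [← pow_add]; congr 1; omega
      rw [h1, h2, zpow_neg, zpow_natCast]
      field_simp
  · refine Finset.sum_congr rfl fun l _ => ?_
    rw [pow_add]; ring

theorem coeff_sum_two_ranges (a b : ℕ → ℂ) (m q k : ℕ) :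
    (∑ l ∈ Finset.range m, C (a l) * X ^ l
      + ∑ l ∈ Finset.range q, C (b l) * X ^ (m + l) : ℂ[X]).coeff k
      = if k < m then a k else if k < m + q then b (k - m) else 0 := by
  simp only [coeff_add, finsetSum_coeff, coeff_C_mul, coeff_X_pow, mul_ite, mul_one, mul_zero,
    Finset.sum_ite_eq, Finset.mem_range]
  by_cases h1 : k < m
  · rw [if_pos h1, if_pos h1, Finset.sum_eq_zero, add_zero]
    intro l _
    rw [if_neg (by omega)]
  · rw [if_neg h1, if_neg h1, zero_add]
    by_cases h2 : k < m + q
    · rw [if_pos h2, Finset.sum_eq_single (k - m)]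
      · rw [if_pos (by omega)]
      · intro l _ hl
        rw [if_neg (by omega)]
      · intro hl
        exact absurd (Finset.mem_range.2 (by omega)) hl
    · rw [if_neg h2]
      refine Finset.sum_eq_zero fun l hl => ?_
      rw [if_neg]
      have := Finset.mem_range.1 hl
      omega

theorem polyF_coeff (n : ℤ) (k : ℕ) : (S.polyF n).coeff k
    = if k < S.pm then S.fm k n else
      if k < S.pm + S.pp then S.fp (S.pp - 1 - (k - S.pm)) n else 0 :=
  coeff_sum_two_ranges (fun l => S.fm l n) (fun l => S.fp (S.pp - 1 - l) n) S.pm S.pp k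

theorem polyH_coeff (n : ℤ) (k : ℕ) : (S.polyH n).coeff k
    = if k < S.pm then S.hm k n else
      if k < S.pm + S.pp then S.hp (S.pp - 1 - (k - S.pm)) n else 0 :=
  coeff_sum_two_ranges (fun l => S.hm l n) (fun l => S.hp (S.pp - 1 - l) n) S.pm S.pp k

theorem polyG_coeff (n : ℤ) (k : ℕ) : (S.polyG n).coeff k
    = if k < S.pm then S.gm k n else
      if k < S.pm + (S.pp + 1) then S.gp (S.pp - (k - S.pm)) n else 0 :=
  coeff_sum_two_ranges (fun l => S.gm l n) (fun l => S.gp (S.pp - l) n) S.pm (S.pp + 1) k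

variable {S}

/-- The normalization makes the coefficient at `p_-` readable from either family, so the range
includes `k = p_-`. -/
theorem polyG_coeff_low (hg : ∀ n, S.gp S.pp n = S.gm S.pm n) (n : ℤ) {k : ℕ} (hk : k ≤ S.pm) :
    (S.polyG n).coeff k = S.gm k n := by
  rw [polyG_coeff]
  rcases hk.lt_or_eq with h | rfl
  · rw [if_pos h]
  · rw [if_neg (lt_irrefl _), if_pos (by omega), Nat.sub_self, Nat.sub_zero, hg]

theorem polyG_coeff_high (n : ℤ) {l : ℕ} (hl : l ≤ S.pp) :
    (S.polyG n).coeff (S.pm + S.pp - l) = S.gp l n := by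
  rw [polyG_coeff, if_neg (by omega), if_pos (by omega)]
  congr 1
  omega

theorem polyF_coeff_low (n : ℤ) {k : ℕ} (hk : k < S.pm) : (S.polyF n).coeff k = S.fm k n := by
  rw [polyF_coeff, if_pos hk]

theorem polyH_coeff_low (n : ℤ) {k : ℕ} (hk : k < S.pm) : (S.polyH n).coeff k = S.hm k n := by
  rw [polyH_coeff, if_pos hk]

theorem polyF_coeff_high (n : ℤ) {l : ℕ} (hl : l < S.pp) :
    (S.polyF n).coeff (S.pm + S.pp - 1 - l) = S.fp l n := by
  rw [polyF_coeff, if_neg (by omega), if_pos (by omega)]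
  congr 1
  omega

theorem polyH_coeff_high (n : ℤ) {l : ℕ} (hl : l < S.pp) :
    (S.polyH n).coeff (S.pm + S.pp - 1 - l) = S.hp l n := by
  rw [polyH_coeff, if_neg (by omega), if_pos (by omega)]
  congr 1
  omega

theorem polyF_coeff_eq_zero (n : ℤ) {k : ℕ} (hk : S.pm + S.pp ≤ k) : (S.polyF n).coeff k = 0 := by
  rw [polyF_coeff, if_neg (by omega), if_neg (by omega)]

theorem polyH_coeff_eq_zero (n : ℤ) {k : ℕ} (hk : S.pm + S.pp ≤ k) : (S.polyH n).coeff k = 0 := by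
  rw [polyH_coeff, if_neg (by omega), if_neg (by omega)]

theorem polyG_coeff_eq_zero (n : ℤ) {k : ℕ} (hk : S.pm + S.pp < k) : (S.polyG n).coeff k = 0 := by
  rw [polyG_coeff, if_neg (by omega), if_neg (by omega)]

theorem natDegree_polyF_le (n : ℤ) {p : ℕ} (hp : S.pm + S.pp = p + 1) :
    (S.polyF n).natDegree ≤ p :=
  natDegree_le_iff_coeff_eq_zero.2 fun _ hk => polyF_coeff_eq_zero n (by omega)

theorem natDegree_polyH_le (n : ℤ) {p : ℕ} (hp : S.pm + S.pp = p + 1) :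
    (S.polyH n).natDegree ≤ p :=
  natDegree_le_iff_coeff_eq_zero.2 fun _ hk => polyH_coeff_eq_zero n (by omega)

theorem natDegree_polyG_le (n : ℤ) {p : ℕ} (hp : S.pm + S.pp = p + 1) :
    (S.polyG n).natDegree ≤ p + 1 :=
  natDegree_le_iff_coeff_eq_zero.2 fun _ hk => polyG_coeff_eq_zero n (by omega)

/-- The coefficient `f_{p_+ - 1, +}` resp. `0` of `z^{p_-}` in `z^{p_-} F`. -/
theorem polyF_coeff_pm (n : ℤ) : (S.polyF n).coeff S.pm = prevCoeff S.fp S.pp n := by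
  rw [polyF_coeff, if_neg (lt_irrefl _)]
  cases h : S.pp with
  | zero => rw [if_neg (by omega)]; rfl
  | succ q => rw [if_pos (by omega)]; simp [prevCoeff]

theorem polyH_coeff_pm (n : ℤ) : (S.polyH n).coeff S.pm = prevCoeff S.hp S.pp n := by
  rw [polyH_coeff, if_neg (lt_irrefl _)]
  cases h : S.pp with
  | zero => rw [if_neg (by omega)]; rfl
  | succ q => rw [if_pos (by omega)]; simp [prevCoeff]

theorem X_mul_polyF_coeff_pm (n : ℤ) : (X * S.polyF n).coeff S.pm = prevCoeff S.fm S.pm n := by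
  cases h : S.pm with
  | zero => simp [prevCoeff]
  | succ q => rw [coeff_X_mul, polyF_coeff_low n (by omega)]; rfl

theorem X_mul_polyH_coeff_pm (n : ℤ) : (X * S.polyH n).coeff S.pm = prevCoeff S.hm S.pm n := by
  cases h : S.pm with
  | zero => simp [prevCoeff]
  | succ q => rw [coeff_X_mul, polyH_coeff_low n (by omega)]; rfl

/-- Every exponent is below `p_-`, equal to `p_-`, or counted from the top. -/
theorem exponent_cases (k : ℕ) : k < S.pm ∨ k = S.pm ∨
    (∃ l, l < S.pp ∧ k = S.pm + S.pp - l) ∨ S.pm + S.pp < k := by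
  by_cases h1 : k < S.pm
  · exact .inl h1
  by_cases h2 : k = S.pm
  · exact .inr (.inl h2)
  by_cases h3 : S.pm + S.pp < k
  · exact .inr (.inr (.inr h3))
  · exact .inr (.inr (.inl ⟨S.pm + S.pp - k, by omega, by omega⟩))

theorem X_mul_polyF_coeff_high (n : ℤ) {l : ℕ} (hl : l < S.pp) :
    (X * S.polyF n).coeff (S.pm + S.pp - l) = S.fp l n := by
  rw [show S.pm + S.pp - l = S.pm + S.pp - 1 - l + 1 by omega, coeff_X_mul, polyF_coeff_high n hl]

theorem X_mul_polyH_coeff_high (n : ℤ) {l : ℕ} (hl : l < S.pp) :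
    (X * S.polyH n).coeff (S.pm + S.pp - l) = S.hp l n := by
  rw [show S.pm + S.pp - l = S.pm + S.pp - 1 - l + 1 by omega, coeff_X_mul, polyH_coeff_high n hl]

theorem X_mul_polyF_coeff_eq_zero (n : ℤ) {k : ℕ} (hk : S.pm + S.pp < k) :
    (X * S.polyF n).coeff k = 0 := by
  obtain ⟨j, rfl⟩ : ∃ j, k = j + 1 := ⟨k - 1, by omega⟩
  rw [coeff_X_mul, polyF_coeff_eq_zero n (by omega)]

theorem X_mul_polyH_coeff_eq_zero (n : ℤ) {k : ℕ} (hk : S.pm + S.pp < k) :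
    (X * S.polyH n).coeff k = 0 := by
  obtain ⟨j, rfl⟩ : ∃ j, k = j + 1 := ⟨k - 1, by omega⟩
  rw [coeff_X_mul, polyH_coeff_eq_zero n (by omega)]

theorem polyF_coeff_high_succ (n : ℤ) {l : ℕ} (hl : l + 1 < S.pp) :
    (S.polyF n).coeff (S.pm + S.pp - (l + 1)) = S.fp l n := by
  rw [show S.pm + S.pp - (l + 1) = S.pm + S.pp - 1 - l by omega, polyF_coeff_high n (by omega)]

theorem polyH_coeff_high_succ (n : ℤ) {l : ℕ} (hl : l + 1 < S.pp) :
    (S.polyH n).coeff (S.pm + S.pp - (l + 1)) = S.hp l n := by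
  rw [show S.pm + S.pp - (l + 1) = S.pm + S.pp - 1 - l by omega, polyH_coeff_high n (by omega)]

/-- Coefficients below `p_-` give the recursion with index `-`, those above give the one with index
`+`, and the coefficient at `p_-`, where the two families meet, is exactly the first stationary
equation. -/
theorem polyF_shift (hplus : S.RecursionPlus) (hminus : S.RecursionMinus)
    (hg : ∀ n, S.gp S.pp n = S.gm S.pm n) (hAL : S.StationaryAL) (n : ℤ) :
    S.polyF n = X * S.polyF (n - 1) + C (S.α n) * (S.polyG n + S.polyG (n - 1)) := by
  ext k
  rw [coeff_add, coeff_C_mul, coeff_add]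
  rcases exponent_cases (S := S) k with h | rfl | ⟨l, hl, rfl⟩ | h
  · rw [polyF_coeff_low n h, polyG_coeff_low hg n h.le, polyG_coeff_low hg (n - 1) h.le]
    cases k with
    | zero =>
      rw [coeff_X_mul_zero, hminus.f_zero, hminus.g_zero, hminus.g_zero]
      ring
    | succ k => rw [coeff_X_mul, polyF_coeff_low _ (by omega), hminus.f_succ]
  · rw [polyF_coeff_pm, X_mul_polyF_coeff_pm, polyG_coeff_low hg n le_rfl,
      polyG_coeff_low hg (n - 1) le_rfl, ← hg n]
    linear_combination (hAL n).1
  · rw [X_mul_polyF_coeff_high _ hl, polyG_coeff_high _ hl.le, polyG_coeff_high _ hl.le]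
    cases l with
    | zero =>
      rw [Nat.sub_zero, polyF_coeff_eq_zero _ le_rfl, hplus.f_zero, hplus.g_zero, hplus.g_zero,
        sub_add_cancel]
      ring
    | succ l =>
      rw [polyF_coeff_high_succ _ hl, hplus.f_succ]
      ring
  · rw [polyF_coeff_eq_zero _ h.le, X_mul_polyF_coeff_eq_zero _ h, polyG_coeff_eq_zero _ h,
      polyG_coeff_eq_zero _ h]
    ring

/-- Same mechanism as in `polyF_shift`; the middle coefficient is the second stationary equation. -/
theorem polyH_shift (hplus : S.RecursionPlus) (hminus : S.RecursionMinus)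
    (hg : ∀ n, S.gp S.pp n = S.gm S.pm n) (hAL : S.StationaryAL) (n : ℤ) :
    X * S.polyH n = S.polyH (n - 1) + C (S.β n) * (S.polyG n + S.polyG (n - 1)) := by
  ext k
  rw [coeff_add, coeff_C_mul, coeff_add]
  rcases exponent_cases (S := S) k with h | rfl | ⟨l, hl, rfl⟩ | h
  · rw [polyH_coeff_low _ h, polyG_coeff_low hg n h.le, polyG_coeff_low hg (n - 1) h.le]
    cases k with
    | zero =>
      rw [coeff_X_mul_zero, hminus.h_zero, hminus.g_zero, hminus.g_zero, sub_add_cancel]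
      ring
    | succ k =>
      rw [coeff_X_mul, polyH_coeff_low _ (by omega), hminus.h_succ]
      ring
  · rw [polyH_coeff_pm, X_mul_polyH_coeff_pm, polyG_coeff_low hg n le_rfl,
      polyG_coeff_low hg (n - 1) le_rfl, ← hg (n - 1)]
    linear_combination -(hAL n).2
  · rw [X_mul_polyH_coeff_high _ hl, polyG_coeff_high _ hl.le, polyG_coeff_high _ hl.le]
    cases l with
    | zero =>
      rw [Nat.sub_zero, polyH_coeff_eq_zero _ le_rfl, hplus.h_zero, hplus.g_zero, hplus.g_zero]
      ring
    | succ l => rw [polyH_coeff_high_succ _ hl, hplus.h_succ]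
  · rw [polyH_coeff_eq_zero _ h.le, X_mul_polyH_coeff_eq_zero _ h, polyG_coeff_eq_zero _ h,
      polyG_coeff_eq_zero _ h]
    ring

/-- The stationary system is not needed: the factor `X` lowers the exponents of `F` and `H`, so the
coefficient at `p_-` still falls under the recursion with index `-`. -/
theorem polyG_shift (hplus : S.RecursionPlus) (hminus : S.RecursionMinus)
    (hg : ∀ n, S.gp S.pp n = S.gm S.pm n) (n : ℤ) :
    S.polyG n - S.polyG (n - 1)
      = X * (C (S.β n) * S.polyF (n - 1) + C (S.α n) * S.polyH n) := by
  have hr : X * (C (S.β n) * S.polyF (n - 1) + C (S.α n) * S.polyH n)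
      = C (S.β n) * (X * S.polyF (n - 1)) + C (S.α n) * (X * S.polyH n) := by ring
  rw [hr]
  ext k
  rw [coeff_sub, coeff_add, coeff_C_mul, coeff_C_mul]
  rcases exponent_cases (S := S) k with h | h | ⟨l, hl, rfl⟩ | h
  · rw [polyG_coeff_low hg _ h.le, polyG_coeff_low hg _ h.le]
    cases k with
    | zero => simp [hminus.g_zero]
    | succ k =>
      rw [coeff_X_mul, coeff_X_mul, polyF_coeff_low _ (by omega), polyH_coeff_low _ (by omega),
        hminus.g_succ]
      ring
  · rw [polyG_coeff_low hg _ h.le, polyG_coeff_low hg _ h.le]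
    cases k with
    | zero => simp [hminus.g_zero]
    | succ k =>
      rw [coeff_X_mul, coeff_X_mul, polyF_coeff_low _ (by omega), polyH_coeff_low _ (by omega),
        hminus.g_succ]
      ring
  · rw [X_mul_polyF_coeff_high _ hl, X_mul_polyH_coeff_high _ hl, polyG_coeff_high _ hl.le,
      polyG_coeff_high _ hl.le]
    cases l with
    | zero =>
      rw [hplus.g_zero, hplus.g_zero, hplus.f_zero, hplus.h_zero, sub_add_cancel]
      ring
    | succ l =>
      -- The recursion for `g` involves `f_l(n)` and `h_l(n-1)`, the claim involves `f_{l+1}(n-1)`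
      -- and `h_{l+1}(n)`; on passing from one to the other the two terms `αβ(g + g⁻)` cancel.
      rw [hplus.g_succ, hplus.f_succ, hplus.h_succ]
      ring
  · rw [X_mul_polyF_coeff_eq_zero _ h, X_mul_polyH_coeff_eq_zero _ h, polyG_coeff_eq_zero _ h,
      polyG_coeff_eq_zero _ h]
    ring

/-- The second form of the difference equation for `z^{p_-} G`. -/
theorem polyG_shift_left (hplus : S.RecursionPlus) (hminus : S.RecursionMinus)
    (hg : ∀ n, S.gp S.pp n = S.gm S.pm n) (hAL : S.StationaryAL) (n : ℤ) :
    S.polyG n - S.polyG (n - 1) = C (S.β n) * S.polyF n + C (S.α n) * S.polyH (n - 1) := by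
  linear_combination polyG_shift hplus hminus hg n
    - C (S.β n) * polyF_shift hplus hminus hg hAL n + C (S.α n) * polyH_shift hplus hminus hg hAL n

/-- The discriminant `z^{2 p_-} R` does not depend on the lattice point. -/
theorem discr_eq (hplus : S.RecursionPlus) (hminus : S.RecursionMinus)
    (hg : ∀ n, S.gp S.pp n = S.gm S.pm n) (hAL : S.StationaryAL) (n : ℤ) :
    S.polyG n ^ 2 - X * S.polyF n * S.polyH n
      = S.polyG 0 ^ 2 - X * S.polyF 0 * S.polyH 0 := by
  -- Both `G² - (G⁻)²` and `zFH - zF⁻H⁻` equal `(G + G⁻)(βF + αH⁻)`.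
  have step : ∀ n : ℤ, S.polyG n ^ 2 - X * S.polyF n * S.polyH n
      = S.polyG (n - 1) ^ 2 - X * S.polyF (n - 1) * S.polyH (n - 1) := fun n => by
    linear_combination (S.polyG n + S.polyG (n - 1)) * polyG_shift_left hplus hminus hg hAL n
      - S.polyF n * polyH_shift hplus hminus hg hAL n
      - S.polyH (n - 1) * polyF_shift hplus hminus hg hAL n
  induction n using Int.induction_on with
  | zero => rfl
  | succ n ih => rw [step, add_sub_cancel_right, ih]
  | pred n ih => rw [← step, ih]

/-- The discriminant as a product over the branch points. -/
theorem discr_eq_prod {p : ℕ} {E : Fin (2 * p + 2) → ℂ} (hplus : S.RecursionPlus)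
    (hminus : S.RecursionMinus) (hg : ∀ n, S.gp S.pp n = S.gm S.pm n) (hAL : S.StationaryAL)
    (hE : ∀ z : ℂ, z ≠ 0 → S.R z 0 = (S.cp / (2 * z ^ S.pm)) ^ 2 * ∏ m, (z - E m)) (n : ℤ) :
    S.polyG n ^ 2 - X * S.polyF n * S.polyH n = C ((S.cp / 2) ^ 2) * ∏ m, (X - C (E m)) := by
  rw [discr_eq hplus hminus hg hAL]
  -- The Laurent expressions are meaningful only for `z ≠ 0`, and agreement there determines the
  -- polynomials.
  refine Polynomial.eq_of_infinite_eval_eq _ _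
    ((Set.finite_singleton (0 : ℂ)).infinite_compl.mono fun z hz => ?_)
  have hz : z ≠ 0 := hz
  have h := hE z hz
  have h2 : z ^ S.pm * z ^ ((S.pm : ℤ) - 1) * z = (z ^ S.pm) ^ 2 := by
    rw [mul_assoc, ← zpow_add_one₀ hz, sub_add_cancel, zpow_natCast, sq]
  simp only [Set.mem_ofPred_eq, eval_sub, eval_pow, eval_mul, eval_X, eval_C, eval_prod,
    polyF_eval _ _ hz, polyG_eval _ _ hz, polyH_eval _ _ hz]
  have h3 : (z ^ S.pm * S.G z 0) ^ 2 - z * (z ^ S.pm * S.F z 0) * (z ^ ((S.pm : ℤ) - 1) * S.H z 0)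
      = (z ^ S.pm) ^ 2 * S.R z 0 := by
    rw [R]
    linear_combination -(S.F z 0 * S.H z 0) * h2
  rw [h3, h]
  field_simp

theorem polyG_coeff_zero (hminus : S.RecursionMinus) (hg : ∀ n, S.gp S.pp n = S.gm S.pm n)
    (n : ℤ) : (S.polyG n).coeff 0 = S.cm / 2 := by
  rw [polyG_coeff_low hg n (Nat.zero_le _), hminus.g_zero]

theorem polyG_coeff_top (hplus : S.RecursionPlus) (n : ℤ) {p : ℕ} (hp : S.pm + S.pp = p + 1) :
    (S.polyG n).coeff (p + 1) = S.cp / 2 := by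
  rw [← hp, ← Nat.sub_zero (S.pm + S.pp), polyG_coeff_high n (Nat.zero_le _), hplus.g_zero]

/-- For `p_- = 0` the constant term is not an initial value of the recursion. Reading it from the
shift relation covers all indices uniformly; the top coefficients below are treated likewise because
of `p_+ = 0`. -/
theorem polyF_coeff_zero (hplus : S.RecursionPlus) (hminus : S.RecursionMinus)
    (hg : ∀ n, S.gp S.pp n = S.gm S.pm n) (hAL : S.StationaryAL) (n : ℤ) :
    (S.polyF n).coeff 0 = S.cm * S.α n := by
  rw [polyF_shift hplus hminus hg hAL, coeff_add, coeff_C_mul, coeff_add, coeff_X_mul_zero,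
    polyG_coeff_zero hminus hg, polyG_coeff_zero hminus hg]
  ring

theorem polyH_coeff_zero (hplus : S.RecursionPlus) (hminus : S.RecursionMinus)
    (hg : ∀ n, S.gp S.pp n = S.gm S.pm n) (hAL : S.StationaryAL) (n : ℤ) :
    (S.polyH n).coeff 0 = -(S.cm * S.β (n + 1)) := by
  have := congrArg (coeff · 0) (polyH_shift hplus hminus hg hAL (n + 1))
  simp only [coeff_add, coeff_C_mul, coeff_X_mul_zero, polyG_coeff_zero hminus hg,
    add_sub_cancel_right] at this
  linear_combination -this

theorem polyF_coeff_top (hplus : S.RecursionPlus) (hminus : S.RecursionMinus)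
    (hg : ∀ n, S.gp S.pp n = S.gm S.pm n) (hAL : S.StationaryAL) (n : ℤ) {p : ℕ}
    (hp : S.pm + S.pp = p + 1) : (S.polyF n).coeff p = -(S.cp * S.α (n + 1)) := by
  have := congrArg (coeff · (p + 1)) (polyF_shift hplus hminus hg hAL (n + 1))
  simp only [coeff_add, coeff_C_mul, coeff_X_mul, polyG_coeff_top hplus _ hp,
    add_sub_cancel_right, polyF_coeff_eq_zero (n + 1) hp.le] at this
  linear_combination -this

theorem polyH_coeff_top (hplus : S.RecursionPlus) (hminus : S.RecursionMinus)
    (hg : ∀ n, S.gp S.pp n = S.gm S.pm n) (hAL : S.StationaryAL) (n : ℤ) {p : ℕ}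
    (hp : S.pm + S.pp = p + 1) : (S.polyH n).coeff p = S.cp * S.β n := by
  have := congrArg (coeff · (p + 1)) (polyH_shift hplus hminus hg hAL n)
  simp only [coeff_add, coeff_C_mul, coeff_X_mul, polyG_coeff_top hplus _ hp,
    polyH_coeff_eq_zero (n - 1) hp.le] at this
  linear_combination this

end ALData

/-! ### Orders of germs -/

/-- `f` is a nonzero meromorphic germ at `0` of order `k`. -/
def HasOrder (f : ℂ → ℂ) (k : ℤ) : Prop := ∃ c : ℂ, c ≠ 0 ∧ HasLeadingTerm f k c

theorem HasLeadingTerm.hasOrder {f : ℂ → ℂ} {k : ℤ} {c : ℂ} (h : HasLeadingTerm f k c)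
    (hc : c ≠ 0) : HasOrder f k := ⟨c, hc, h⟩

namespace HasOrder

variable {f f₁ f₂ : ℂ → ℂ} {k k₁ k₂ : ℤ}

theorem congr (h : HasOrder f₁ k) (e : ∀ᶠ ζ in 𝓝[≠] (0 : ℂ), f₂ ζ = f₁ ζ) : HasOrder f₂ k := by
  obtain ⟨c, hc, h⟩ := h
  exact ⟨c, hc, h.congr e⟩

theorem mul (h₁ : HasOrder f₁ k₁) (h₂ : HasOrder f₂ k₂) :
    HasOrder (fun ζ => f₁ ζ * f₂ ζ) (k₁ + k₂) := by
  obtain ⟨c₁, hc₁, h₁⟩ := h₁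
  obtain ⟨c₂, hc₂, h₂⟩ := h₂
  exact ⟨_, mul_ne_zero hc₁ hc₂, h₁.mul h₂⟩

theorem div (h₁ : HasOrder f₁ k₁) (h₂ : HasOrder f₂ k₂) :
    HasOrder (fun ζ => f₁ ζ / f₂ ζ) (k₁ - k₂) := by
  obtain ⟨c₁, hc₁, h₁⟩ := h₁
  obtain ⟨c₂, hc₂, h₂⟩ := h₂
  exact ⟨_, div_ne_zero hc₁ hc₂, h₁.div h₂ hc₂⟩

theorem const_mul (h : HasOrder f k) {a : ℂ} (ha : a ≠ 0) : HasOrder (fun ζ => a * f ζ) k := by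
  obtain ⟨c, hc, h⟩ := h
  exact ⟨_, mul_ne_zero ha hc, h.const_mul a⟩

theorem of_analyticAt (hf : AnalyticAt ℂ f 0) (h0 : f 0 ≠ 0) : HasOrder f 0 :=
  ⟨_, h0, .of_analyticAt hf⟩

theorem eventually_ne_zero (h : HasOrder f k) : ∀ᶠ ζ in 𝓝[≠] (0 : ℂ), f ζ ≠ 0 := by
  obtain ⟨c, hc, h⟩ := h
  exact h.eventually_ne_zero hc

theorem latticeProd {a : ℤ → ℂ → ℂ} {d : ℤ → ℤ} (ha : ∀ k, HasOrder (a k) (d k - d (k - 1)))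
    (n n₀ : ℤ) : HasOrder (fun ζ => latticeProd (fun k => a k ζ) n n₀) (d n - d n₀) := by
  choose c hc h using ha
  exact ⟨_, latticeProd_ne_zero hc n n₀, HasLeadingTerm.latticeProd h hc n n₀⟩

end HasOrder

/-! ### Polynomials in local coordinates -/

theorem hasOrder_eval_add_pow {q : ℂ[X]} (hq : q ≠ 0) (z₀ : ℂ) {e : ℕ} (he : e ≠ 0) :
    HasOrder (fun ζ => q.eval (z₀ + ζ ^ e)) (e * q.rootMultiplicity z₀ : ℕ) := by
  obtain ⟨r, hr, hdvd⟩ := exists_eq_pow_rootMultiplicity_mul_and_not_dvd q hq z₀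
  set m := q.rootMultiplicity z₀
  refine ⟨r.eval z₀, fun h => hdvd (dvd_iff_isRoot.2 h), fun ζ => r.eval (z₀ + ζ ^ e), ?_, ?_, ?_⟩
  · have : AnalyticAt ℂ (fun ζ : ℂ => z₀ + ζ ^ e) 0 :=
      analyticAt_const.add (analyticAt_id.pow e)
    exact this.aeval_polynomial r
  · simp [he]
  · filter_upwards with ζ
    rw [hr]
    simp only [eval_mul, eval_pow, eval_sub, eval_X, eval_C, add_sub_cancel_left]
    rw [zpow_natCast, ← pow_mul]

theorem analyticAt_eval_add_pow (q : ℂ[X]) (z₀ : ℂ) (e : ℕ) :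
    AnalyticAt ℂ (fun ζ : ℂ => q.eval (z₀ + ζ ^ e)) 0 := by
  have : AnalyticAt ℂ (fun ζ : ℂ => z₀ + ζ ^ e) 0 := analyticAt_const.add (analyticAt_id.pow e)
  exact this.aeval_polynomial q

/-- The analytic factor is the polynomial with reversed coefficients, relative to degree `d`. -/
theorem hasLeadingTerm_eval_inv {q : ℂ[X]} {d : ℕ} (hq : q.natDegree ≤ d) :
    HasLeadingTerm (fun ζ => q.eval ζ⁻¹) (-(d : ℤ)) (q.coeff d) := by
  refine ⟨fun ζ => ∑ i ∈ Finset.range (d + 1), q.coeff i * ζ ^ (d - i), ?_, ?_, ?_⟩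
  · exact Finset.analyticAt_fun_sum _ fun i _ => analyticAt_const.mul (analyticAt_id.pow _)
  · beta_reduce
    rw [Finset.sum_range_succ, Finset.sum_eq_zero, Nat.sub_self]
    · simp
    · intro i hi
      have := Finset.mem_range.1 hi
      rw [zero_pow (by omega), mul_zero]
  · filter_upwards [eventually_ne_zero_punctured] with ζ h0
    rw [eval_eq_sum_range' (Nat.lt_succ_of_le hq), Finset.mul_sum]
    refine Finset.sum_congr rfl fun i hi => ?_
    have hi := Finset.mem_range.1 hi
    have : ζ ^ d = ζ ^ i * ζ ^ (d - i) := by rw [← pow_add]; congr 1; omega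
    rw [zpow_neg, zpow_natCast, this, inv_pow]
    field_simp

/-! ### The curve in local coordinates -/

section Curve

variable {p : ℕ} {E : Fin (2 * p + 2) → ℂ}

/-- The principal root is analytic near `1`; the radicands depending on `ζ` in `localParam` are
normalized to equal `1` at the centre for this reason. -/
theorem analyticAt_sqrt {f : ℂ → ℂ} (hf : AnalyticAt ℂ f 0) (h : f 0 = 1) :
    AnalyticAt ℂ (fun ζ => f ζ ^ (1 / 2 : ℂ)) 0 :=
  hf.cpow analyticAt_const (by rw [h]; exact Complex.one_mem_slitPlane)

theorem analyticAt_prod_sub {ι : Type*} (s : Finset ι) (E : ι → ℂ) (z₀ : ℂ) (e : ℕ) :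
    AnalyticAt ℂ (fun ζ : ℂ => ∏ m ∈ s, (z₀ + ζ ^ e - E m)) 0 :=
  Finset.analyticAt_fun_prod _ fun _ _ =>
    (analyticAt_const.add (analyticAt_id.pow e)).sub analyticAt_const

/-- The exponent `1` is kept so that ordinary and branch points share the form `z₀ + ζ ^ e`. -/
theorem localParam_affine_z {z₀ y₀ : ℂ} (h : y₀ ≠ 0) (ζ : ℂ) :
    (localParam E (.affine z₀ y₀) ζ).z = z₀ + ζ ^ 1 := by
  simp [localParam, h, CurvePt.z]

theorem localParam_branch_z (z₀ ζ : ℂ) :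
    (localParam E (.affine z₀ 0) ζ).z = z₀ + ζ ^ 2 := by
  simp [localParam, CurvePt.z]

theorem localParam_infPlus_z (ζ : ℂ) : (localParam E .infPlus ζ).z = ζ⁻¹ := by
  by_cases h : ζ = 0 <;> simp [localParam, h, CurvePt.z]

theorem localParam_infMinus_z (ζ : ℂ) : (localParam E .infMinus ζ).z = ζ⁻¹ := by
  by_cases h : ζ = 0 <;> simp [localParam, h, CurvePt.z]

theorem analyticAt_localParam_affine_y {z₀ y₀ : ℂ} (hQ : .affine z₀ y₀ ∈ hyperCurve E)
    (h : y₀ ≠ 0) : AnalyticAt ℂ (fun ζ => (localParam E (.affine z₀ y₀) ζ).y) 0 := by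
  have hQ' : y₀ ^ 2 = ∏ m, (z₀ - E m) := hQ
  have h0 : ∏ m, (z₀ - E m) ≠ 0 := by rw [← hQ']; exact pow_ne_zero 2 h
  simp only [localParam, h, if_false, CurvePt.y]
  refine analyticAt_const.mul (analyticAt_sqrt (AnalyticAt.div ?_ analyticAt_const h0) ?_)
  · simpa using analyticAt_prod_sub Finset.univ E z₀ 1
  · simp [div_self h0]

theorem hasOrder_localParam_branch_y (z₀ : ℂ) :
    HasOrder (fun ζ => (localParam E (.affine z₀ 0) ζ).y) 1 := by
  classical
  have h0 : ∏ m ∈ Finset.univ.filter (fun m => E m ≠ z₀), (z₀ - E m) ≠ 0 :=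
    Finset.prod_ne_zero_iff.2 fun m hm => sub_ne_zero.2 (Finset.mem_filter.1 hm).2.symm
  set s := Finset.univ.filter (fun m => E m ≠ z₀)
  refine ⟨_, ?_, fun ζ => (∏ m ∈ s, (z₀ - E m)) ^ (1 / 2 : ℂ)
    * ((∏ m ∈ s, (z₀ + ζ ^ 2 - E m)) / ∏ m ∈ s, (z₀ - E m)) ^ (1 / 2 : ℂ), ?_, rfl, ?_⟩
  · simpa [div_self h0, Complex.cpow_eq_zero_iff] using h0
  · refine analyticAt_const.mul (analyticAt_sqrt (AnalyticAt.div ?_ analyticAt_const h0) ?_)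
    · exact analyticAt_prod_sub s E z₀ 2
    · simp [div_self h0]
  · filter_upwards with ζ
    simp only [localParam, if_true, CurvePt.y, zpow_one]
    rfl

theorem hasLeadingTerm_inf_sqrt :
    HasLeadingTerm (fun ζ => (ζ ^ (p + 1))⁻¹ * (∏ m, (1 - E m * ζ)) ^ (1 / 2 : ℂ))
      (-((p : ℤ) + 1)) 1 := by
  refine ⟨fun ζ => (∏ m, (1 - E m * ζ)) ^ (1 / 2 : ℂ), analyticAt_sqrt ?_ (by simp), by simp, ?_⟩
  · exact Finset.analyticAt_fun_prod _ fun m _ =>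
      analyticAt_const.sub (analyticAt_const.mul analyticAt_id)
  · filter_upwards with ζ
    rw [zpow_neg]
    norm_cast

theorem hasLeadingTerm_localParam_infPlus_y :
    HasLeadingTerm (fun ζ => (localParam E .infPlus ζ).y) (-((p : ℤ) + 1)) (-1) := by
  refine hasLeadingTerm_inf_sqrt (E := E).neg.congr ?_
  filter_upwards [eventually_ne_zero_punctured] with ζ h0
  simp [localParam, h0, CurvePt.y]

theorem hasLeadingTerm_localParam_infMinus_y :
    HasLeadingTerm (fun ζ => (localParam E .infMinus ζ).y) (-((p : ℤ) + 1)) 1 := by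
  refine hasLeadingTerm_inf_sqrt (E := E).congr ?_
  filter_upwards [eventually_ne_zero_punctured] with ζ h0
  simp [localParam, h0, CurvePt.y]

/-- The ramification index of the projection to the `z`-plane at a finite point `(z, y)`. -/
def ramification (y₀ : ℂ) : ℕ := open Classical in if y₀ = 0 then 2 else 1

theorem ramification_ne_zero (y₀ : ℂ) : ramification y₀ ≠ 0 := by
  rw [ramification]; split_ifs <;> simp

theorem localParam_affine_z_eq (z₀ y₀ ζ : ℂ) :
    (localParam E (.affine z₀ y₀) ζ).z = z₀ + ζ ^ ramification y₀ := by
  by_cases h : y₀ = 0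
  · subst h
    simp [localParam_branch_z, ramification]
  · simp [localParam_affine_z h, ramification, h]

theorem hasOrder_eval_localParam {q : ℂ[X]} (hq : q ≠ 0) (z₀ y₀ : ℂ) :
    HasOrder (fun ζ => q.eval (localParam E (.affine z₀ y₀) ζ).z)
      (ramification y₀ * q.rootMultiplicity z₀ : ℕ) := by
  simp only [localParam_affine_z_eq]
  exact hasOrder_eval_add_pow hq z₀ (ramification_ne_zero y₀)

theorem eventually_eval_localParam_ne_zero {q : ℂ[X]} (hq : q ≠ 0) (Q : CurvePt) :
    ∀ᶠ ζ in 𝓝[≠] (0 : ℂ), q.eval (localParam E Q ζ).z ≠ 0 := by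
  cases Q with
  | affine z₀ y₀ => exact (hasOrder_eval_localParam hq z₀ y₀).eventually_ne_zero
  | infPlus =>
    simp only [localParam_infPlus_z]
    exact (hasLeadingTerm_eval_inv le_rfl).eventually_ne_zero (by simpa using hq)
  | infMinus =>
    simp only [localParam_infMinus_z]
    exact (hasLeadingTerm_eval_inv le_rfl).eventually_ne_zero (by simpa using hq)

theorem eventually_localParam_eq (hEinj : Function.Injective E) {Q : CurvePt}
    (hQ : Q ∈ hyperCurve E) : ∀ᶠ ζ in 𝓝[≠] (0 : ℂ),
      (localParam E Q ζ).y ^ 2 = ∏ m, ((localParam E Q ζ).z - E m) := by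
  -- The centre is excluded because `z` and `y` take dummy values at the points at infinity.
  filter_upwards [eventually_ne_zero_punctured] with ζ h0
  have h := localParam_mem E hEinj hQ ζ
  have h1 : ∃ z y, localParam E Q ζ = .affine z y := by
    cases Q with
    | affine z₀ y₀ => by_cases h : y₀ = 0 <;> simp [localParam, h]
    | infPlus => simp [localParam, h0]
    | infMinus => simp [localParam, h0]
  obtain ⟨z, y, h1⟩ := h1
  rw [h1] at h ⊢
  exact h

/-- `g²` vanishes doubly at `z₀`, whereas `∏ (z - E_m)` vanishes only simply since the `E_m` are
distinct; hence `A' (z₀) ≠ 0`. -/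
theorem rootMultiplicity_eq_one_of_discr (hEinj : Function.Injective E) {c z₀ : ℂ} (hc : c ≠ 0)
    {g A : ℂ[X]} (h : g ^ 2 - A = C (c ^ 2) * ∏ m, (X - C (E m)))
    (hz : ∏ m, (z₀ - E m) = 0) (hg : g.eval z₀ = 0) : A.rootMultiplicity z₀ = 1 := by
  obtain ⟨m₀, -, hm₀⟩ := Finset.prod_eq_zero_iff.1 hz
  have hm : E m₀ = z₀ := (sub_eq_zero.1 hm₀).symm
  have hA : A = g ^ 2 - C (c ^ 2) * ∏ m, (X - C (E m)) := by rw [← h]; ring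
  rw [← Finset.mul_prod_erase _ _ (Finset.mem_univ m₀), hm] at hA
  set r := ∏ m ∈ Finset.univ.erase m₀, (X - C (E m)) with hr
  have hr0 : r.eval z₀ ≠ 0 := by
    rw [hr, eval_prod]
    refine Finset.prod_ne_zero_iff.2 fun m hmm => ?_
    rw [eval_sub, eval_X, eval_C, ← hm]
    exact sub_ne_zero.2 fun e => (Finset.ne_of_mem_erase hmm) (hEinj e).symm
  have hd : (derivative A).eval z₀ ≠ 0 := by
    rw [hA]
    simp only [derivative_sub, derivative_mul, derivative_pow, derivative_C, derivative_X, eval_sub,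
      eval_mul, eval_add, eval_pow, eval_C, eval_X, hg]
    simpa using ⟨hc, hr0⟩
  have hA0 : A ≠ 0 := by
    rintro rfl
    simp at hd
  have h1 : A.IsRoot z₀ := by simp [hA, IsRoot, hg]
  have h2 : 0 < A.rootMultiplicity z₀ := (rootMultiplicity_pos hA0).2 h1
  have h3 : ¬1 < A.rootMultiplicity z₀ := fun h4 =>
    hd ((one_lt_rootMultiplicity_iff_isRoot hA0).1 h4).2
  omega

open Classical in
/-- If `g² - A = c² ∏ (z - E_m)`, the order of `c y + g(z)` at a finite point of the curve is the
multiplicity of `A` there, or `0` if the function does not vanish. -/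
theorem hasOrder_sqrt_add (hEinj : Function.Injective E) {c z₀ y₀ : ℂ} (hc : c ≠ 0)
    (hQ : .affine z₀ y₀ ∈ hyperCurve E) {g A : ℂ[X]} (hA : A ≠ 0)
    (h : g ^ 2 - A = C (c ^ 2) * ∏ m, (X - C (E m))) :
    HasOrder (fun ζ => c * (localParam E (.affine z₀ y₀) ζ).y
        + g.eval (localParam E (.affine z₀ y₀) ζ).z)
      (if c * y₀ + g.eval z₀ = 0 then A.rootMultiplicity z₀ else 0) := by
  have hQ' : y₀ ^ 2 = ∏ m, (z₀ - E m) := hQ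
  have h0 : localParam E (.affine z₀ y₀) 0 = .affine z₀ y₀ := localParam_zero E hQ
  have hev := eventually_localParam_eq hEinj hQ
  by_cases hy : y₀ = 0
  · subst hy
    have hz : ∏ m, (z₀ - E m) = 0 := by rw [← hQ']; simp
    obtain ⟨s, hs, hys⟩ := hasOrder_localParam_branch_y (E := E) z₀
    have hga : HasLeadingTerm (fun ζ => g.eval (localParam E (.affine z₀ 0) ζ).z) 0
        (g.eval z₀) := by
      simp only [localParam_branch_z]
      simpa using HasLeadingTerm.of_analyticAt (analyticAt_eval_add_pow g z₀ 2)
    by_cases hg : g.eval z₀ = 0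
    · rw [if_pos (by simp [hg]), rootMultiplicity_eq_one_of_discr hEinj hc h hz hg]
      -- As a function of `ζ²`, `g` vanishes to order at least `2`, so `y`, of order `1`, dominates.
      have hg1 : HasLeadingTerm (fun ζ => g.eval (localParam E (.affine z₀ 0) ζ).z) 1 0 := by
        by_cases hg0 : g = 0
        · subst hg0
          exact ⟨fun _ => 0, analyticAt_const, rfl, by simp⟩
        · obtain ⟨b, -, hb⟩ := hasOrder_eval_localParam (E := E) hg0 z₀ 0
          refine hb.of_lt ?_
          have := (rootMultiplicity_pos hg0).2 hg
          simp only [ramification, if_true]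
          omega
      have := (hys.const_mul c).add hg1
      rw [add_zero] at this
      exact this.hasOrder (mul_ne_zero hc hs)
    · rw [if_neg (by simpa using hg)]
      have := ((hys.const_mul c).of_lt one_pos).add hga
      rw [zero_add] at this
      exact this.hasOrder hg
  · have hya := analyticAt_localParam_affine_y hQ hy
    have hga : AnalyticAt ℂ (fun ζ => g.eval (localParam E (.affine z₀ y₀) ζ).z) 0 := by
      simp only [localParam_affine_z hy]
      exact analyticAt_eval_add_pow g z₀ 1
    by_cases hv : c * y₀ + g.eval z₀ = 0
    · rw [if_pos hv]
      -- The conjugate `g - cy` takes the value `-2cy₀ ≠ 0` here, and `(cy + g)(g - cy) = A(z)` on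
      -- the curve, so the numerator inherits the order of `A`.
      have hconj : HasOrder (fun ζ => g.eval (localParam E (.affine z₀ y₀) ζ).z
          - c * (localParam E (.affine z₀ y₀) ζ).y) 0 := by
        refine .of_analyticAt (hga.sub (analyticAt_const.mul hya)) ?_
        rw [h0]
        change g.eval z₀ - c * y₀ ≠ 0
        have : g.eval z₀ - c * y₀ = -2 * (c * y₀) := by linear_combination hv
        rw [this]
        exact mul_ne_zero (by norm_num) (mul_ne_zero hc hy)
      have hq := (hasOrder_eval_localParam (E := E) hA z₀ y₀).div hconj
      rw [ramification, if_neg hy, one_mul, sub_zero] at hq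
      refine hq.congr ?_
      filter_upwards [hev, hconj.eventually_ne_zero] with ζ h1 h2
      have h3 := congrArg (eval (localParam E (.affine z₀ y₀) ζ).z) h
      simp only [eval_sub, eval_pow, eval_mul, eval_C, eval_prod, eval_X] at h3
      rw [eq_div_iff h2]
      linear_combination h3 - c ^ 2 * h1
    · rw [if_neg hv]
      refine .of_analyticAt ((analyticAt_const.mul hya).add hga) ?_
      rw [h0]
      exact hv

end Curve

/-! ### Nonsingular stationary data: boundary coefficients, discriminant, points on the curve -/

namespace ALData

/-- Nonsingular stationary Ablowitz-Ladik data of index `(p_-, p_+)` with branch points `E_m`. -/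
structure IsStationary (S : ALData) {p : ℕ} (E : Fin (2 * p + 2) → ℂ) : Prop where
  αβ_ne : ∀ n, S.α n * S.β n ≠ 0 ∧ S.α n * S.β n ≠ 1
  cm_ne : S.cm ≠ 0
  cp_ne : S.cp ≠ 0
  index : S.pm + S.pp = p + 1
  plus : S.RecursionPlus
  minus : S.RecursionMinus
  normalized : ∀ n, S.gp S.pp n = S.gm S.pm n
  stationary : S.StationaryAL
  curve : ∀ z : ℂ, z ≠ 0 → S.R z 0 = (S.cp / (2 * z ^ S.pm)) ^ 2 * ∏ m, (z - E m)
  inj : Function.Injective E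

namespace IsStationary

variable {S : ALData} {p : ℕ} {E : Fin (2 * p + 2) → ℂ}

theorem α_ne (hS : S.IsStationary E) (n : ℤ) : S.α n ≠ 0 := left_ne_zero_of_mul (hS.αβ_ne n).1

theorem β_ne (hS : S.IsStationary E) (n : ℤ) : S.β n ≠ 0 := right_ne_zero_of_mul (hS.αβ_ne n).1

theorem γ_ne (hS : S.IsStationary E) (n : ℤ) : S.γ n ≠ 0 := sub_ne_zero.2 (hS.αβ_ne n).2.symm

theorem half_cp_ne (hS : S.IsStationary E) : S.cp / 2 ≠ 0 := div_ne_zero hS.cp_ne two_ne_zero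

theorem F_coeff_zero (hS : S.IsStationary E) (n : ℤ) : (S.polyF n).coeff 0 = S.cm * S.α n :=
  polyF_coeff_zero hS.plus hS.minus hS.normalized hS.stationary n

theorem H_coeff_zero (hS : S.IsStationary E)
    (n : ℤ) : (S.polyH n).coeff 0 = -(S.cm * S.β (n + 1)) :=
  polyH_coeff_zero hS.plus hS.minus hS.normalized hS.stationary n

theorem F_eval_zero (hS : S.IsStationary E) (n : ℤ) : (S.polyF n).eval 0 = S.cm * S.α n := by
  rw [← coeff_zero_eq_eval_zero, hS.F_coeff_zero]

theorem H_eval_zero (hS : S.IsStationary E)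
    (n : ℤ) : (S.polyH n).eval 0 = -(S.cm * S.β (n + 1)) := by
  rw [← coeff_zero_eq_eval_zero, hS.H_coeff_zero]

theorem G_eval_zero (hS : S.IsStationary E) (n : ℤ) : (S.polyG n).eval 0 = S.cm / 2 := by
  rw [← coeff_zero_eq_eval_zero, polyG_coeff_zero hS.minus hS.normalized]

theorem polyF_ne_zero (hS : S.IsStationary E) (n : ℤ) : S.polyF n ≠ 0 := fun h => by
  have := hS.F_coeff_zero n
  rw [h, coeff_zero] at this
  exact mul_ne_zero hS.cm_ne (hS.α_ne n) this.symm

theorem polyH_ne_zero (hS : S.IsStationary E) (n : ℤ) : S.polyH n ≠ 0 := fun h => by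
  have := hS.H_coeff_zero n
  rw [h, coeff_zero] at this
  exact neg_ne_zero.2 (mul_ne_zero hS.cm_ne (hS.β_ne _)) this.symm

theorem mu_ne_zero (hS : S.IsStationary E)
    {n : ℤ} {μ : ℂ} (h : (S.polyF n).eval μ = 0) : μ ≠ 0 := by
  rintro rfl
  rw [hS.F_eval_zero] at h
  exact mul_ne_zero hS.cm_ne (hS.α_ne n) h

theorem nu_ne_zero (hS : S.IsStationary E)
    {n : ℤ} {ν : ℂ} (h : (S.polyH n).eval ν = 0) : ν ≠ 0 := by
  rintro rfl
  rw [hS.H_eval_zero] at h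
  exact neg_ne_zero.2 (mul_ne_zero hS.cm_ne (hS.β_ne _)) h

theorem F_coeff_top (hS : S.IsStationary E) (n : ℤ) : (S.polyF n).coeff p = -(S.cp * S.α (n + 1)) :=
  polyF_coeff_top hS.plus hS.minus hS.normalized hS.stationary n hS.index

theorem H_coeff_top (hS : S.IsStationary E) (n : ℤ) : (S.polyH n).coeff p = S.cp * S.β n :=
  polyH_coeff_top hS.plus hS.minus hS.normalized hS.stationary n hS.index

theorem card_mu (hS : S.IsStationary E) (n : ℤ) : (S.mu n).card = p := by
  rw [mu, IsAlgClosed.card_roots_eq_natDegree]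
  refine le_antisymm (natDegree_polyF_le n hS.index) (le_natDegree_of_ne_zero ?_)
  rw [hS.F_coeff_top]
  exact neg_ne_zero.2 (mul_ne_zero hS.cp_ne (hS.α_ne _))

theorem card_nu (hS : S.IsStationary E) (n : ℤ) : (S.nu n).card = p := by
  rw [nu, IsAlgClosed.card_roots_eq_natDegree]
  refine le_antisymm (natDegree_polyH_le n hS.index) (le_natDegree_of_ne_zero ?_)
  rw [hS.H_coeff_top]
  exact mul_ne_zero hS.cp_ne (hS.β_ne _)

theorem discr (hS : S.IsStationary E) (n : ℤ) :
    S.polyG n ^ 2 - X * S.polyF n * S.polyH n = C ((S.cp / 2) ^ 2) * ∏ m, (X - C (E m)) :=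
  discr_eq_prod hS.plus hS.minus hS.normalized hS.stationary hS.curve n

theorem discr_eval (hS : S.IsStationary E) (n : ℤ) (z : ℂ) :
    (S.polyG n).eval z ^ 2 - z * (S.polyF n).eval z * (S.polyH n).eval z
      = (S.cp / 2) ^ 2 * ∏ m, (z - E m) := by
  simpa [eval_prod] using congrArg (eval z) (hS.discr n)

theorem F_shift (hS : S.IsStationary E)
    (n : ℤ) (z : ℂ) : (S.polyF n).eval z = z * (S.polyF (n - 1)).eval z
    + S.α n * ((S.polyG n).eval z + (S.polyG (n - 1)).eval z) := by
  simpa using congrArg (eval z) (polyF_shift hS.plus hS.minus hS.normalized hS.stationary n)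

theorem G_shift (hS : S.IsStationary E)
    (n : ℤ) (z : ℂ) : (S.polyG n).eval z - (S.polyG (n - 1)).eval z
    = z * (S.β n * (S.polyF (n - 1)).eval z + S.α n * (S.polyH n).eval z) := by
  simpa using congrArg (eval z) (polyG_shift hS.plus hS.minus hS.normalized n)

theorem prod_branch (hS : S.IsStationary E) : (S.cm / S.cp) ^ 2 = ∏ m, (0 - E m) := by
  have h := hS.discr_eval 0 0
  rw [hS.G_eval_zero, zero_mul, zero_mul, sub_zero] at h
  have := hS.cp_ne
  field_simp at h ⊢
  exact h

theorem zeroPlus_mem (hS : S.IsStationary E) : S.zeroPlus ∈ hyperCurve E := hS.prod_branch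

theorem zeroMinus_mem (hS : S.IsStationary E) : S.zeroMinus ∈ hyperCurve E := by
  change (-(S.cm / S.cp)) ^ 2 = ∏ m, (0 - E m)
  rw [neg_sq, hS.prod_branch]

theorem muHat_eq (hS : S.IsStationary E) {n : ℤ} {μ : ℂ} (h : (S.polyF n).eval μ = 0) :
    S.muHat n μ = .affine μ (2 / S.cp * (S.polyG n).eval μ) := by
  rw [muHat, polyG_eval _ _ (hS.mu_ne_zero h), mul_assoc]

theorem nuHat_eq (hS : S.IsStationary E) {n : ℤ} {ν : ℂ} (h : (S.polyH n).eval ν = 0) :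
    S.nuHat n ν = .affine ν (-(2 / S.cp * (S.polyG n).eval ν)) := by
  rw [nuHat, polyG_eval _ _ (hS.nu_ne_zero h), mul_assoc]

theorem muHat_mem (hS : S.IsStationary E)
    {n : ℤ} {μ : ℂ} (h : (S.polyF n).eval μ = 0) : S.muHat n μ ∈ hyperCurve E := by
  rw [hS.muHat_eq h]
  change (2 / S.cp * (S.polyG n).eval μ) ^ 2 = ∏ m, (μ - E m)
  have h1 := hS.discr_eval n μ
  rw [h] at h1
  have := hS.cp_ne
  field_simp at h1 ⊢
  linear_combination h1

theorem nuHat_mem (hS : S.IsStationary E)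
    {n : ℤ} {ν : ℂ} (h : (S.polyH n).eval ν = 0) : S.nuHat n ν ∈ hyperCurve E := by
  rw [hS.nuHat_eq h]
  change (-(2 / S.cp * (S.polyG n).eval ν)) ^ 2 = ∏ m, (ν - E m)
  have h1 := hS.discr_eval n ν
  rw [h] at h1
  have := hS.cp_ne
  field_simp at h1 ⊢
  linear_combination h1

/-! ### The function `φ` on the curve -/

theorem phi_eq (P : CurvePt) (hz : P.z ≠ 0) (n : ℤ) : S.phi P n
    = (S.cp / 2 * P.y + (S.polyG n).eval P.z) / (S.polyF n).eval P.z := by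
  rw [phi, polyF_eval _ _ hz, polyG_eval _ _ hz,
    ← mul_div_mul_left _ (S.F P.z n) (pow_ne_zero S.pm hz)]
  congr 1
  rw [zpow_neg, zpow_natCast]
  field_simp

/-- Needed at `P_{∞+}` and `P_{0,-}`, where the leading terms of `cy + G` cancel while those of `G -
cy` add up. -/
theorem phi_eq_conj (hS : S.IsStationary E)
    {P : CurvePt} (hz : P.z ≠ 0) (hP : P.y ^ 2 = ∏ m, (P.z - E m)) {n : ℤ}
    (hF : (S.polyF n).eval P.z ≠ 0) (hc : (S.polyG n).eval P.z - S.cp / 2 * P.y ≠ 0) :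
    S.phi P n = P.z * (S.polyH n).eval P.z / ((S.polyG n).eval P.z - S.cp / 2 * P.y) := by
  rw [phi_eq P hz, div_eq_div_iff hF hc]
  linear_combination hS.discr_eval n P.z - (S.cp / 2) ^ 2 * hP

/-- The Riccati-type equation for `φ`. -/
theorem riccati (hS : S.IsStationary E)
    {P : CurvePt} (hz : P.z ≠ 0) (hP : P.y ^ 2 = ∏ m, (P.z - E m)) {n : ℤ}
    (hF : (S.polyF n).eval P.z ≠ 0) (hF' : (S.polyF (n - 1)).eval P.z ≠ 0) :
    S.phi P n * (P.z + S.α n * S.phi P (n - 1)) = P.z * S.β n + S.phi P (n - 1) := by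
  rw [phi_eq P hz, phi_eq P hz]
  field_simp
  have h1 := hS.discr_eval n P.z
  have h2 := hS.F_shift n P.z
  have h3 := hS.G_shift n P.z
  set a := (S.polyF n).eval P.z
  set a' := (S.polyF (n - 1)).eval P.z
  set b := (S.polyG n).eval P.z
  set b' := (S.polyG (n - 1)).eval P.z
  -- With denominators cleared, the curve equation and the discriminant at `n` eliminate `y²`; the
  -- shifts of `F` and `G` account for the rest.
  linear_combination -4 * S.α n * h1 + S.α n * S.cp ^ 2 * hP
    - 2 * (S.cp * P.y + 2 * b) * h2 + 4 * a * h3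

/-- Near any point of the curve the Riccati-type equation holds. -/
theorem eventually_riccati (hS : S.IsStationary E) {Q : CurvePt} (hQ : Q ∈ hyperCurve E) (n : ℤ) :
    ∀ᶠ ζ in 𝓝[≠] (0 : ℂ), S.phi (localParam E Q ζ) n
      * ((localParam E Q ζ).z + S.α n * S.phi (localParam E Q ζ) (n - 1))
      = (localParam E Q ζ).z * S.β n + S.phi (localParam E Q ζ) (n - 1) := by
  have hX := eventually_eval_localParam_ne_zero (E := E) (X_ne_zero (R := ℂ)) Q
  simp only [eval_X] at hX
  filter_upwards [hX, eventually_localParam_eq hS.inj hQ,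
    eventually_eval_localParam_ne_zero (E := E) (hS.polyF_ne_zero n) Q,
    eventually_eval_localParam_ne_zero (E := E) (hS.polyF_ne_zero (n - 1)) Q] with ζ h1 h2 h3 h4
  exact hS.riccati h1 h2 h3 h4

theorem eventually_phi_eq (Q : CurvePt) (n : ℤ) :
    ∀ᶠ ζ in 𝓝[≠] (0 : ℂ), S.phi (localParam E Q ζ) n
      = (S.cp / 2 * (localParam E Q ζ).y + (S.polyG n).eval (localParam E Q ζ).z)
        / (S.polyF n).eval (localParam E Q ζ).z := by
  have hX := eventually_eval_localParam_ne_zero (E := E) (X_ne_zero (R := ℂ)) Q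
  simp only [eval_X] at hX
  filter_upwards [hX] with ζ h1
  exact phi_eq _ h1 n

theorem eventually_phi_eq_conj (hS : S.IsStationary E) {Q : CurvePt} (hQ : Q ∈ hyperCurve E) (n : ℤ)
    (hc : ∀ᶠ ζ in 𝓝[≠] (0 : ℂ),
      (S.polyG n).eval (localParam E Q ζ).z - S.cp / 2 * (localParam E Q ζ).y ≠ 0) :
    ∀ᶠ ζ in 𝓝[≠] (0 : ℂ), S.phi (localParam E Q ζ) n
      = (localParam E Q ζ).z * (S.polyH n).eval (localParam E Q ζ).z
        / ((S.polyG n).eval (localParam E Q ζ).z - S.cp / 2 * (localParam E Q ζ).y) := by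
  have hX := eventually_eval_localParam_ne_zero (E := E) (X_ne_zero (R := ℂ)) Q
  simp only [eval_X] at hX
  filter_upwards [hX, eventually_localParam_eq hS.inj hQ, hc,
    eventually_eval_localParam_ne_zero (E := E) (hS.polyF_ne_zero n) Q] with ζ h1 h2 h3 h4
  exact hS.phi_eq_conj h1 h2 h4 h3

/-! ### `φ` and its shifts near the four special points -/

theorem phi_infPlus (hS : S.IsStationary E) (n : ℤ) :
    HasLeadingTerm (fun ζ => S.phi (localParam E .infPlus ζ) n) 0 (S.β n) := by
  have hG := hasLeadingTerm_eval_inv (natDegree_polyG_le n hS.index)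
  have hH := (HasLeadingTerm.zpow_id (-1)).mul
    (hasLeadingTerm_eval_inv (natDegree_polyH_le n hS.index))
  rw [polyG_coeff_top hS.plus n hS.index] at hG
  rw [hS.H_coeff_top] at hH
  have hd := hG.sub ((hasLeadingTerm_localParam_infPlus_y (E := E)).const_mul (S.cp / 2))
  rw [show S.cp / 2 - S.cp / 2 * -1 = S.cp by ring] at hd
  have he := hS.eventually_phi_eq_conj (Q := .infPlus) trivial n (by
    simp only [localParam_infPlus_z]; exact hd.eventually_ne_zero hS.cp_ne)
  have := hH.div hd hS.cp_ne
  rw [show -1 + -(p : ℤ) - -((p + 1 : ℕ) : ℤ) = 0 by push_cast; ring,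
    one_mul, mul_div_cancel_left₀ _ hS.cp_ne] at this
  refine this.congr ?_
  filter_upwards [he] with ζ h
  rw [h, localParam_infPlus_z, zpow_neg_one]

theorem phi_infMinus (hS : S.IsStationary E) (n : ℤ) :
    HasLeadingTerm (fun ζ => S.phi (localParam E .infMinus ζ) n) (-1) (-(S.α (n + 1))⁻¹) := by
  have hG := hasLeadingTerm_eval_inv (natDegree_polyG_le n hS.index)
  have hF := hasLeadingTerm_eval_inv (natDegree_polyF_le n hS.index)
  rw [polyG_coeff_top hS.plus n hS.index] at hG
  rw [hS.F_coeff_top] at hF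
  have hd := ((hasLeadingTerm_localParam_infMinus_y (E := E)).const_mul (S.cp / 2)).add hG
  have hc := hS.cp_ne
  have hα := hS.α_ne (n + 1)
  have := hd.div hF (neg_ne_zero.2 (mul_ne_zero hc hα))
  rw [show -((p : ℤ) + 1) - -(p : ℤ) = -1 by ring,
    show (S.cp / 2 * 1 + S.cp / 2) / -(S.cp * S.α (n + 1)) = -(S.α (n + 1))⁻¹ by
      field_simp; ring] at this
  refine this.congr ?_
  filter_upwards [eventually_phi_eq (E := E) .infMinus n] with ζ h
  rw [h, localParam_infMinus_z]

theorem hasLeadingTerm_eval_zero (q : ℂ[X]) {y₀ : ℂ} (hy : y₀ ≠ 0) :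
    HasLeadingTerm (fun ζ => q.eval (localParam E (.affine 0 y₀) ζ).z) 0 (q.eval 0) := by
  simp only [localParam_affine_z hy]
  simpa using HasLeadingTerm.of_analyticAt (analyticAt_eval_add_pow q 0 1)

theorem hasLeadingTerm_y {z₀ y₀ : ℂ} (hQ : .affine z₀ y₀ ∈ hyperCurve E) (hy : y₀ ≠ 0) :
    HasLeadingTerm (fun ζ => (localParam E (.affine z₀ y₀) ζ).y) 0 y₀ := by
  have := HasLeadingTerm.of_analyticAt (analyticAt_localParam_affine_y hQ hy)
  rwa [localParam_zero E hQ] at this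

theorem cm_div_cp_ne (hS : S.IsStationary E) : S.cm / S.cp ≠ 0 := div_ne_zero hS.cm_ne hS.cp_ne

theorem localParam_zeroPlus_z (hS : S.IsStationary E)
    (ζ : ℂ) : (localParam E S.zeroPlus ζ).z = ζ := by
  rw [zeroPlus, localParam_affine_z hS.cm_div_cp_ne, zero_add, pow_one]

theorem localParam_zeroMinus_z (hS : S.IsStationary E)
    (ζ : ℂ) : (localParam E S.zeroMinus ζ).z = ζ := by
  rw [zeroMinus, localParam_affine_z (neg_ne_zero.2 hS.cm_div_cp_ne), zero_add, pow_one]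

theorem phi_zeroPlus (hS : S.IsStationary E) (n : ℤ) :
    HasLeadingTerm (fun ζ => S.phi (localParam E S.zeroPlus ζ) n) 0 (S.α n)⁻¹ := by
  have hy := hS.cm_div_cp_ne
  have hG := hasLeadingTerm_eval_zero (E := E) (S.polyG n) hy
  have hF := hasLeadingTerm_eval_zero (E := E) (S.polyF n) hy
  rw [hS.G_eval_zero] at hG
  rw [hS.F_eval_zero] at hF
  have hc := hS.cp_ne
  have hm := hS.cm_ne
  have hα := hS.α_ne n
  have := (((hasLeadingTerm_y hS.zeroPlus_mem hy).const_mul (S.cp / 2)).add hG).div hF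
    (mul_ne_zero hm hα)
  rw [sub_zero, show (S.cp / 2 * (S.cm / S.cp) + S.cm / 2) / (S.cm * S.α n) = (S.α n)⁻¹ by
      field_simp; ring] at this
  exact this.congr (eventually_phi_eq (E := E) S.zeroPlus n)

theorem phi_zeroMinus (hS : S.IsStationary E) (n : ℤ) :
    HasLeadingTerm (fun ζ => S.phi (localParam E S.zeroMinus ζ) n) 1 (-S.β (n + 1)) := by
  have hy := neg_ne_zero.2 hS.cm_div_cp_ne
  have hG := hasLeadingTerm_eval_zero (E := E) (S.polyG n) hy
  have hH := (HasLeadingTerm.zpow_id 1).mul (hasLeadingTerm_eval_zero (E := E) (S.polyH n) hy)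
  rw [hS.G_eval_zero] at hG
  rw [hS.H_eval_zero] at hH
  have hc := hS.cp_ne
  have hm := hS.cm_ne
  have hd := hG.sub ((hasLeadingTerm_y hS.zeroMinus_mem hy).const_mul (S.cp / 2))
  rw [show S.cm / 2 - S.cp / 2 * -(S.cm / S.cp) = S.cm by field_simp; ring] at hd
  have he := hS.eventually_phi_eq_conj hS.zeroMinus_mem n (hd.eventually_ne_zero hm)
  have := hH.div hd hm
  rw [show (1 : ℤ) + 0 - 0 = 1 by ring,
    show 1 * -(S.cm * S.β (n + 1)) / S.cm = -S.β (n + 1) by field_simp] at this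
  refine this.congr ?_
  filter_upwards [he] with ζ h
  rw [h, zpow_one]
  nth_rewrite 1 [hS.localParam_zeroMinus_z]
  rfl

/-- Divided by `z`, the Riccati equation reads `φ - β = ζφ⁻(1 - αφ)`, so leading terms on the right
give the next term on the left. -/
theorem phi_sub_infPlus (hS : S.IsStationary E) (n : ℤ) : HasLeadingTerm
    (fun ζ => S.phi (localParam E .infPlus ζ) n - S.β n) 1 (S.β (n - 1) * S.γ n) := by
  have h1 := (hS.phi_infPlus (n - 1)).mul
    ((HasLeadingTerm.const 1).sub ((hS.phi_infPlus n).const_mul (S.α n)))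
  refine ((HasLeadingTerm.zpow_id 1).mul h1).congr ?_ |> fun h => by simpa [γ] using h
  filter_upwards [eventually_ne_zero_punctured,
    hS.eventually_riccati (Q := .infPlus) trivial n] with ζ h0 h
  rw [localParam_infPlus_z] at h
  field_simp at h
  rw [zpow_one]
  linear_combination h

/-- With `u = -ζφ⁺`, the Riccati equation at `n + 1` becomes `(φ + z/α⁺) · α⁺(α⁺u + ζ) = γ⁺`, and
`u` tends to `1/α⁺⁺`. -/
theorem phi_sub_infMinus (hS : S.IsStationary E) (n : ℤ) : HasLeadingTerm
    (fun ζ => S.phi (localParam E .infMinus ζ) n - -(S.α (n + 1))⁻¹ * ζ⁻¹) 0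
    ((S.α (n + 1) ^ 2)⁻¹ * S.α (n + 2) * S.γ (n + 1)) := by
  have hα := hS.α_ne (n + 1)
  have hα' := hS.α_ne (n + 2)
  have hu := ((HasLeadingTerm.zpow_id 1).mul (hS.phi_infMinus (n + 1))).neg
  rw [show n + 1 + 1 = n + 2 by ring, show (1 : ℤ) + -1 = 0 by ring] at hu
  have hd := ((hu.const_mul (S.α (n + 1))).add
    ((HasLeadingTerm.zpow_id 1).of_lt one_pos)).const_mul (S.α (n + 1))
  have hd0 : S.α (n + 1) * (S.α (n + 1) * -(1 * -(S.α (n + 2))⁻¹) + 0) ≠ 0 := by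
    simp [hα, hα']
  have := (HasLeadingTerm.const (S.γ (n + 1))).div hd hd0
  rw [sub_zero, show S.γ (n + 1) / (S.α (n + 1) * (S.α (n + 1) * -(1 * -(S.α (n + 2))⁻¹) + 0))
    = (S.α (n + 1) ^ 2)⁻¹ * S.α (n + 2) * S.γ (n + 1) by
      simp only [one_mul, neg_neg, add_zero]; field_simp] at this
  refine this.congr ?_
  filter_upwards [eventually_ne_zero_punctured, hd.eventually_ne_zero hd0,
    hS.eventually_riccati (Q := .infMinus) trivial (n + 1)] with ζ h0 h1 h
  rw [localParam_infMinus_z, add_sub_cancel_right] at h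
  rw [eq_div_iff h1, γ, zpow_one]
  field_simp at h ⊢
  linear_combination -S.α (n + 1) * h

/-- The Riccati equation is equivalent to `(φ - 1/α) · α(ζ + αφ⁻) = -γζ`. -/
theorem phi_sub_zeroPlus (hS : S.IsStationary E) (n : ℤ) : HasLeadingTerm
    (fun ζ => S.phi (localParam E S.zeroPlus ζ) n - (S.α n)⁻¹) 1
    (-((S.α n ^ 2)⁻¹ * S.α (n - 1) * S.γ n)) := by
  have hα := hS.α_ne n
  have hα' := hS.α_ne (n - 1)
  have hd := (((HasLeadingTerm.zpow_id 1).of_lt one_pos).add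
    ((hS.phi_zeroPlus (n - 1)).const_mul (S.α n))).const_mul (S.α n)
  have hd0 : S.α n * (0 + S.α n * (S.α (n - 1))⁻¹) ≠ 0 := by simp [hα, hα']
  have := ((HasLeadingTerm.zpow_id 1).const_mul (-S.γ n)).div hd hd0
  rw [sub_zero, show -S.γ n * 1 / (S.α n * (0 + S.α n * (S.α (n - 1))⁻¹))
    = -((S.α n ^ 2)⁻¹ * S.α (n - 1) * S.γ n) by simp only [zero_add, mul_one]; field_simp] at this
  refine this.congr ?_
  filter_upwards [hd.eventually_ne_zero hd0, hS.eventually_riccati hS.zeroPlus_mem n] with ζ h1 h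
  rw [hS.localParam_zeroPlus_z] at h
  rw [eq_div_iff h1, γ, zpow_one]
  field_simp
  linear_combination S.α n * h

/-- The Riccati equation at `n + 1` is equivalent to `(φ + β⁺ζ)(1 - α⁺φ⁺) = γ⁺ζφ⁺`. -/
theorem phi_sub_zeroMinus (hS : S.IsStationary E) (n : ℤ) : HasLeadingTerm
    (fun ζ => S.phi (localParam E S.zeroMinus ζ) n - -S.β (n + 1) * ζ) 2
    (-(S.β (n + 2) * S.γ (n + 1))) := by
  have hφ := hS.phi_zeroMinus (n + 1)
  rw [show n + 1 + 1 = n + 2 by ring] at hφ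
  have hd := (HasLeadingTerm.const 1).sub ((hφ.of_lt one_pos).const_mul (S.α (n + 1)))
  have hd0 : 1 - S.α (n + 1) * 0 ≠ 0 := by simp
  have := (((HasLeadingTerm.zpow_id 1).mul hφ).const_mul (S.γ (n + 1))).div hd hd0
  rw [show (1 : ℤ) + 1 - 0 = 2 by ring, show S.γ (n + 1) * (1 * -S.β (n + 2))
    / (1 - S.α (n + 1) * 0) = -(S.β (n + 2) * S.γ (n + 1)) by simp [mul_comm]] at this
  refine this.congr ?_
  filter_upwards [hd.eventually_ne_zero hd0,
    hS.eventually_riccati hS.zeroMinus_mem (n + 1)] with ζ h1 h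
  rw [hS.localParam_zeroMinus_z, add_sub_cancel_right] at h
  rw [eq_div_iff h1, γ, zpow_one]
  linear_combination -h

/-! ### The factors of `ψ₁` near the four special points -/

theorem factor_infPlus (hS : S.IsStationary E)
    (n : ℤ) : HasLeadingTerm (fun ζ => (localParam E .infPlus ζ).z
    + S.α n * S.phi (localParam E .infPlus ζ) (n - 1)) (-1) 1 := by
  have := (HasLeadingTerm.zpow_id (-1)).add
    (((hS.phi_infPlus (n - 1)).const_mul (S.α n)).of_lt (k := -1) (by norm_num))
  simpa [localParam_infPlus_z] using this

/-- The pole of `αφ⁻` cancels `z`, so the value comes from the second term of the expansion of `φ⁻`.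
-/
theorem factor_infMinus (hS : S.IsStationary E)
    (n : ℤ) : HasLeadingTerm (fun ζ => (localParam E .infMinus ζ).z
    + S.α n * S.phi (localParam E .infMinus ζ) (n - 1)) 0 (S.α (n + 1) / S.α n * S.γ n) := by
  have hα := hS.α_ne n
  have := (hS.phi_sub_infMinus (n - 1)).const_mul (S.α n)
  rw [show n - 1 + 1 = n by ring, show n - 1 + 2 = n + 1 by ring,
    show S.α n * ((S.α n ^ 2)⁻¹ * S.α (n + 1) * S.γ n) = S.α (n + 1) / S.α n * S.γ n by
      field_simp] at this
  refine this.congr (.of_forall fun ζ => ?_)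
  rw [localParam_infMinus_z]
  field_simp
  ring

theorem factor_zeroPlus (hS : S.IsStationary E)
    (n : ℤ) : HasLeadingTerm (fun ζ => (localParam E S.zeroPlus ζ).z
    + S.α n * S.phi (localParam E S.zeroPlus ζ) (n - 1)) 0 (S.α n / S.α (n - 1)) := by
  have := ((HasLeadingTerm.zpow_id 1).of_lt one_pos).add
    ((hS.phi_zeroPlus (n - 1)).const_mul (S.α n))
  simpa [hS.localParam_zeroPlus_z, div_eq_mul_inv] using this

theorem factor_zeroMinus (hS : S.IsStationary E)
    (n : ℤ) : HasLeadingTerm (fun ζ => (localParam E S.zeroMinus ζ).z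
    + S.α n * S.phi (localParam E S.zeroMinus ζ) (n - 1)) 1 (S.γ n) := by
  have := (HasLeadingTerm.zpow_id 1).add ((hS.phi_zeroMinus (n - 1)).const_mul (S.α n))
  simpa [hS.localParam_zeroMinus_z, γ, sub_eq_add_neg] using this

/-! ### `ψ₁` near the four special points -/

theorem psi1_infPlus (hS : S.IsStationary E) (n n₀ : ℤ) :
    HasLeadingTerm (fun ζ => S.psi1 (localParam E .infPlus ζ) n n₀) (n₀ - n) 1 := by
  have := HasLeadingTerm.latticeProd (d := fun k => -k) (c := fun _ => 1)
    (fun k => by rw [show -k - -(k - 1) = -1 by ring]; exact hS.factor_infPlus k)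
    (fun _ => one_ne_zero) n n₀
  rwa [latticeProd_one, show -n - -n₀ = n₀ - n by ring] at this

theorem psi1_infMinus (hS : S.IsStationary E) (n n₀ : ℤ) :
    HasLeadingTerm (fun ζ => S.psi1 (localParam E .infMinus ζ) n n₀) 0
      (S.α (n + 1) / S.α (n₀ + 1) * S.Gam n n₀) := by
  have h := HasLeadingTerm.latticeProd (d := fun _ => 0)
    (c := fun k => S.α (k + 1) / S.α (k - 1 + 1) * S.γ k)
    (fun k => by simpa using hS.factor_infMinus k)
    (fun k => mul_ne_zero (div_ne_zero (hS.α_ne _) (hS.α_ne _)) (hS.γ_ne _)) n n₀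
  rwa [latticeProd_mul, latticeProd_telescope (u := fun k => S.α (k + 1)) fun k _ => hS.α_ne _]
    at h

theorem psi1_zeroPlus (hS : S.IsStationary E) (n n₀ : ℤ) :
    HasLeadingTerm (fun ζ => S.psi1 (localParam E S.zeroPlus ζ) n n₀) 0 (S.α n / S.α n₀) := by
  have h := HasLeadingTerm.latticeProd (d := fun _ => 0) (c := fun k => S.α k / S.α (k - 1))
    (fun k => by simpa using hS.factor_zeroPlus k)
    (fun k => div_ne_zero (hS.α_ne _) (hS.α_ne _)) n n₀
  rwa [latticeProd_telescope fun k _ => hS.α_ne _] at h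

theorem psi1_zeroMinus (hS : S.IsStationary E) (n n₀ : ℤ) :
    HasLeadingTerm (fun ζ => S.psi1 (localParam E S.zeroMinus ζ) n n₀) (n - n₀) (S.Gam n n₀) :=
  HasLeadingTerm.latticeProd (d := fun k => k) (c := S.γ)
    (fun k => by simpa using hS.factor_zeroMinus k) hS.γ_ne n n₀

/-! ### Values of the divisors -/

theorem divMu_apply_of_ne {n : ℤ} {Q : CurvePt}
    (hQ : ∀ μ, (S.polyF n).eval μ = 0 → S.muHat n μ ≠ Q) : S.divMu n Q = 0 := by
  have h : ∀ μ ∈ S.mu n, ptDiv (S.muHat n μ) Q = 0 := fun μ hμ =>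
    Finsupp.single_eq_of_ne (hQ μ (isRoot_of_mem_roots hμ)).symm
  rw [divMu, ← Finsupp.applyAddHom_apply Q, map_multiset_sum, Multiset.map_map]
  exact Multiset.sum_eq_zero fun x hx => by
    obtain ⟨μ, hμ, rfl⟩ := Multiset.mem_map.1 hx
    exact h μ hμ

theorem divNu_apply_of_ne {n : ℤ} {Q : CurvePt}
    (hQ : ∀ ν, (S.polyH n).eval ν = 0 → S.nuHat n ν ≠ Q) : S.divNu n Q = 0 := by
  have h : ∀ ν ∈ S.nu n, ptDiv (S.nuHat n ν) Q = 0 := fun ν hν =>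
    Finsupp.single_eq_of_ne (hQ ν (isRoot_of_mem_roots hν)).symm
  rw [divNu, ← Finsupp.applyAddHom_apply Q, map_multiset_sum, Multiset.map_map]
  exact Multiset.sum_eq_zero fun x hx => by
    obtain ⟨ν, hν, rfl⟩ := Multiset.mem_map.1 hx
    exact h ν hν

/-- The value at `(z₀, y₀)` of the divisor of the lifts `(z, Y z)` of a multiset. -/
theorem sum_ptDiv_lift (s : Multiset ℂ) (Y : ℂ → ℂ) (z₀ y₀ : ℂ) :
    (s.map fun z => ptDiv (.affine z (Y z))).sum (.affine z₀ y₀)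
      = open Classical in if y₀ = Y z₀ then (s.count z₀ : ℤ) else 0 := by
  classical
  induction s using Multiset.induction_on with
  | empty => simp
  | cons a s ih =>
    rw [Multiset.map_cons, Multiset.sum_cons, Finsupp.add_apply, ih, ptDiv,
      Finsupp.single_apply, Multiset.count_cons]
    by_cases h : z₀ = a
    · subst h
      by_cases h2 : y₀ = Y z₀
      · subst h2
        simp [add_comm]
      · simp [h2, Ne.symm h2]
    · simp [h, Ne.symm h]

open Classical in
theorem divMu_apply (hS : S.IsStationary E) (n : ℤ) {z₀ : ℂ} (hz : z₀ ≠ 0) (y₀ : ℂ) :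
    S.divMu n (.affine z₀ y₀) = if S.cp / 2 * y₀ = (S.polyG n).eval z₀
      then ((S.polyF n).rootMultiplicity z₀ : ℤ) else 0 := by
  have hc := hS.cp_ne
  have h : y₀ = 2 / S.cp * z₀ ^ S.pm * S.G z₀ n ↔ S.cp / 2 * y₀ = (S.polyG n).eval z₀ := by
    rw [polyG_eval _ _ hz]
    constructor
    · rintro rfl
      field_simp
    · intro h
      rw [mul_assoc, ← h]
      field_simp
  simp only [divMu, muHat]
  rw [sum_ptDiv_lift _ (fun μ => 2 / S.cp * μ ^ S.pm * S.G μ n), mu, count_roots]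
  simp only [h]

open Classical in
theorem divNu_apply (hS : S.IsStationary E) (n : ℤ) {z₀ : ℂ} (hz : z₀ ≠ 0) (y₀ : ℂ) :
    S.divNu n (.affine z₀ y₀) = if S.cp / 2 * y₀ = -(S.polyG n).eval z₀
      then ((S.polyH n).rootMultiplicity z₀ : ℤ) else 0 := by
  have hc := hS.cp_ne
  have h : y₀ = -(2 / S.cp * z₀ ^ S.pm * S.G z₀ n)
      ↔ S.cp / 2 * y₀ = -(S.polyG n).eval z₀ := by
    rw [polyG_eval _ _ hz]
    constructor
    · rintro rfl
      field_simp
    · intro h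
      rw [mul_assoc, eq_neg_iff_add_eq_zero, ← neg_eq_iff_eq_neg.2 h]
      field_simp
      ring
  simp only [divNu, nuHat]
  rw [sum_ptDiv_lift _ (fun ν => -(2 / S.cp * ν ^ S.pm * S.G ν n)), nu, count_roots]
  simp only [h]

theorem divMu_apply_zero (hS : S.IsStationary E) (n : ℤ) (y₀ : ℂ) : S.divMu n (.affine 0 y₀) = 0 :=
  divMu_apply_of_ne fun μ hμ h => hS.mu_ne_zero hμ (by injection h)

theorem divNu_apply_zero (hS : S.IsStationary E) (n : ℤ) (y₀ : ℂ) : S.divNu n (.affine 0 y₀) = 0 :=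
  divNu_apply_of_ne fun ν hν h => hS.nu_ne_zero hν (by injection h)

theorem zeroPlus_ne_zeroMinus (hS : S.IsStationary E) : S.zeroPlus ≠ S.zeroMinus := by
  intro h
  injection h with _ h
  have h2 : S.cm / S.cp = 0 := by linear_combination h / 2
  exact hS.cm_div_cp_ne h2

theorem eq_zeroPlus_or_zeroMinus (hS : S.IsStationary E)
    {y₀ : ℂ} (h : .affine 0 y₀ ∈ hyperCurve E) :
    .affine 0 y₀ = S.zeroPlus ∨ .affine 0 y₀ = S.zeroMinus := by
  have h : y₀ ^ 2 = ∏ m, (0 - E m) := h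
  rw [← hS.prod_branch] at h
  rcases sq_eq_sq_iff_eq_or_eq_neg.1 h with rfl | rfl
  · exact .inl rfl
  · exact .inr rfl

/-! ### Orders of `φ` and of the factors of `ψ₁` -/

open Classical in
/-- A zero of `z^{p_-} F`, counted with ramification, is shared between `μ̂` and its conjugate. -/
theorem ramification_mul_F (hS : S.IsStationary E)
    (n : ℤ) {z₀ y₀ : ℂ} (hQ : .affine z₀ y₀ ∈ hyperCurve E) :
    ((ramification y₀ * (S.polyF n).rootMultiplicity z₀ : ℕ) : ℤ)
      = (if S.cp / 2 * y₀ = (S.polyG n).eval z₀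
          then ((S.polyF n).rootMultiplicity z₀ : ℤ) else 0)
        + if S.cp / 2 * y₀ = -(S.polyG n).eval z₀
          then ((S.polyF n).rootMultiplicity z₀ : ℤ) else 0 := by
  have hQ' : y₀ ^ 2 = ∏ m, (z₀ - E m) := hQ
  -- At a zero of `F` the discriminant gives `G² = (cy₀)²`. Exactly one sign occurs if `y₀ ≠ 0`;
  -- both occur at a branch point, matching ramification index `2`.
  by_cases hF : (S.polyF n).eval z₀ = 0
  · have h := hS.discr_eval n z₀
    rw [hF, ← hQ', mul_zero, zero_mul, sub_zero] at h
    by_cases hy : y₀ = 0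
    · subst hy
      have hG : (S.polyG n).eval z₀ = 0 := by simpa using h
      simp only [ramification, hG, mul_zero, neg_zero, if_true]
      push_cast
      ring
    · have hY : S.cp / 2 * y₀ ≠ 0 := mul_ne_zero hS.half_cp_ne hy
      rw [← mul_pow] at h
      have hne : ∀ w : ℂ, w ≠ 0 → w ≠ -w := fun w hw e => hw (by linear_combination e / 2)
      rcases sq_eq_sq_iff_eq_or_eq_neg.1 h.symm with e | e
      · rw [← e, if_pos rfl, if_neg (hne _ hY)]
        simp [ramification, hy]
      · have e' : (S.polyG n).eval z₀ = -(S.cp / 2 * y₀) := by rw [e, neg_neg]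
        rw [e', neg_neg, if_neg (hne _ hY), if_pos rfl]
        simp [ramification, hy]
  · have : (S.polyF n).rootMultiplicity z₀ = 0 := rootMultiplicity_eq_zero hF
    simp [this]

/-- The numerator vanishes where `cy₀ = -G`, with the multiplicities of `F` and `H` added. Its `F`
part removes the zeros of the denominator at the conjugates of `μ̂`, leaving zeros at `ν̂` and poles
at `μ̂`. -/
theorem phi_hasOrder_finite (hS : S.IsStationary E) (n : ℤ) {z₀ y₀ : ℂ} (hz : z₀ ≠ 0)
    (hQ : .affine z₀ y₀ ∈ hyperCurve E) :
    HasOrder (fun ζ => S.phi (localParam E (.affine z₀ y₀) ζ) n)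
      (S.divNu n (.affine z₀ y₀) - S.divMu n (.affine z₀ y₀)) := by
  classical
  have hFne := hS.polyF_ne_zero n
  have hHne := hS.polyH_ne_zero n
  have hA : X * S.polyF n * S.polyH n ≠ 0 := mul_ne_zero (mul_ne_zero X_ne_zero hFne) hHne
  have h1 := hasOrder_sqrt_add hS.inj hS.half_cp_ne hQ hA (hS.discr n)
  have h2 := h1.div (hasOrder_eval_localParam (E := E) hFne z₀ y₀)
  have hm : (X * S.polyF n * S.polyH n).rootMultiplicity z₀
      = (S.polyF n).rootMultiplicity z₀ + (S.polyH n).rootMultiplicity z₀ := by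
    rw [rootMultiplicity_mul hA, rootMultiplicity_mul (mul_ne_zero X_ne_zero hFne),
      rootMultiplicity_eq_zero (p := X) (by simpa using hz), zero_add]
  rw [hS.ramification_mul_F n hQ, hm] at h2
  have h3 := h2.congr (eventually_phi_eq (E := E) _ n)
  rw [hS.divMu_apply n hz, hS.divNu_apply n hz]
  convert h3 using 1
  simp only [eq_neg_iff_add_eq_zero]
  split_ifs <;> push_cast <;> ring

theorem factor_hasOrder_finite (hS : S.IsStationary E) (n : ℤ) {z₀ y₀ : ℂ} (hz : z₀ ≠ 0)
    (hQ : .affine z₀ y₀ ∈ hyperCurve E) :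
    HasOrder (fun ζ => (localParam E (.affine z₀ y₀) ζ).z
        + S.α n * S.phi (localParam E (.affine z₀ y₀) ζ) (n - 1))
      (S.divMu n (.affine z₀ y₀) - S.divMu (n - 1) (.affine z₀ y₀)) := by
  classical
  have hα := hS.α_ne n
  have hFne := hS.polyF_ne_zero n
  have hFne' := hS.polyF_ne_zero (n - 1)
  -- Chosen so that `z + αφ⁻ = α(cy + g)/F⁻`; `A` is then the resulting discriminant defect.
  set g : ℂ[X] := S.polyG (n - 1) + C (S.α n)⁻¹ * (X * S.polyF (n - 1)) with hg
  set A : ℂ[X] := C (S.γ n * (S.α n)⁻¹ ^ 2) * (X * S.polyF (n - 1) * S.polyF n) with hAdef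
  have hγ : S.γ n * (S.α n)⁻¹ ^ 2 ≠ 0 :=
    mul_ne_zero (hS.γ_ne n) (pow_ne_zero 2 (inv_ne_zero hα))
  have hA' : X * S.polyF (n - 1) * S.polyF n ≠ 0 :=
    mul_ne_zero (mul_ne_zero X_ne_zero hFne') hFne
  have hA : A ≠ 0 := mul_ne_zero (by simpa using hγ) hA'
  have hm : A.rootMultiplicity z₀
      = (S.polyF (n - 1)).rootMultiplicity z₀ + (S.polyF n).rootMultiplicity z₀ := by
    rw [hAdef, rootMultiplicity_mul hA, rootMultiplicity_C, rootMultiplicity_mul hA',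
      rootMultiplicity_mul (mul_ne_zero X_ne_zero hFne'),
      rootMultiplicity_eq_zero (p := X) (by simpa using hz), zero_add, zero_add]
  have hdisc : g ^ 2 - A = C ((S.cp / 2) ^ 2) * ∏ m, (X - C (E m)) := by
    have e1 := hS.discr (n - 1)
    have e2 := polyF_shift hS.plus hS.minus hS.normalized hS.stationary n
    have e3 := polyG_shift_left hS.plus hS.minus hS.normalized hS.stationary n
    have e4 : C (S.α n)⁻¹ * C (S.α n) = (1 : ℂ[X]) := by
      rw [← C_mul, inv_mul_cancel₀ hα, C_1]
    have e5 : C (S.γ n * (S.α n)⁻¹ ^ 2)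
        = (1 - C (S.α n) * C (S.β n)) * C (S.α n)⁻¹ ^ 2 := by
      rw [C_mul, C_pow, γ, C_sub, C_mul, C_1]
    have e6 : (1 - C (S.α n) * C (S.β n)) * S.polyF n = X * S.polyF (n - 1)
        + 2 * C (S.α n) * S.polyG (n - 1) + C (S.α n) ^ 2 * S.polyH (n - 1) := by
      linear_combination e2 + C (S.α n) * e3
    rw [← e1, hg, hAdef, e5]
    linear_combination -(C (S.α n)⁻¹ ^ 2 * X * S.polyF (n - 1)) * e6
      - (2 * C (S.α n)⁻¹ * X * S.polyF (n - 1) * S.polyG (n - 1)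
        + (C (S.α n)⁻¹ * C (S.α n) + 1) * X * S.polyF (n - 1) * S.polyH (n - 1)) * e4
  have h1 := (hasOrder_sqrt_add hS.inj hS.half_cp_ne hQ hA hdisc).const_mul hα
  have h2 := h1.div (hasOrder_eval_localParam (E := E) hFne' z₀ y₀)
  rw [hS.ramification_mul_F (n - 1) hQ, hm] at h2
  have h3 : HasOrder _ _ := h2.congr (f₂ := fun ζ => (localParam E (.affine z₀ y₀) ζ).z
      + S.α n * S.phi (localParam E (.affine z₀ y₀) ζ) (n - 1)) (by
    filter_upwards [eventually_phi_eq (S := S) (E := E) (.affine z₀ y₀) (n - 1),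
      eventually_eval_localParam_ne_zero (E := E) hFne' (.affine z₀ y₀)] with ζ e1 e2
    rw [e1, hg]
    simp only [eval_add, eval_mul, eval_C, eval_X]
    field_simp
    ring)
  have hgz : g.eval z₀ = (S.polyG (n - 1)).eval z₀
      + (S.α n)⁻¹ * (z₀ * (S.polyF (n - 1)).eval z₀) := by simp [hg]
  -- The two forms of `g` locate the zeros of `cy + g`: over zeros of `F` they lie at `μ̂(n)`, over
  -- zeros of `F⁻` at the conjugates of `μ̂(n-1)`, where the denominator cancels them.
  have hgz' : g.eval z₀ = -(S.polyG n).eval z₀ + (S.α n)⁻¹ * (S.polyF n).eval z₀ := by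
    rw [hgz, hS.F_shift n z₀]
    field_simp
    ring
  have hi : (if S.cp / 2 * y₀ + g.eval z₀ = 0
        then ((S.polyF (n - 1)).rootMultiplicity z₀ : ℤ) else 0)
      = if S.cp / 2 * y₀ = -(S.polyG (n - 1)).eval z₀
        then ((S.polyF (n - 1)).rootMultiplicity z₀ : ℤ) else 0 := by
    by_cases hF : (S.polyF (n - 1)).eval z₀ = 0
    · rw [hgz, hF, mul_zero, mul_zero, add_zero]
      simp only [eq_neg_iff_add_eq_zero]
    · simp [rootMultiplicity_eq_zero (p := S.polyF (n - 1)) hF]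
  have hi' : (if S.cp / 2 * y₀ + g.eval z₀ = 0
        then ((S.polyF n).rootMultiplicity z₀ : ℤ) else 0)
      = if S.cp / 2 * y₀ = (S.polyG n).eval z₀
        then ((S.polyF n).rootMultiplicity z₀ : ℤ) else 0 := by
    by_cases hF : (S.polyF n).eval z₀ = 0
    · rw [hgz', hF, mul_zero, add_zero]
      simp only [← sub_eq_add_neg, sub_eq_zero]
    · simp [rootMultiplicity_eq_zero (p := S.polyF n) hF]
  rw [hS.divMu_apply n hz, hS.divMu_apply (n - 1) hz, ← hi']
  convert h3 using 1
  rw [← hi]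
  split_ifs <;> push_cast <;> ring

theorem phi_hasOrder (hS : S.IsStationary E) (n : ℤ) {Q : CurvePt} (hQ : Q ∈ hyperCurve E) :
    HasOrder (fun ζ => S.phi (localParam E Q ζ) n)
      ((S.divNu n - S.divMu n + ptDiv S.zeroMinus - ptDiv .infMinus) Q) := by
  simp only [Finsupp.sub_apply, Finsupp.add_apply]
  cases Q with
  | affine z₀ y₀ =>
    have hi : ptDiv .infMinus (.affine z₀ y₀) = 0 := Finsupp.single_eq_of_ne (by simp)
    by_cases hz : z₀ = 0
    · subst hz
      rw [hS.divMu_apply_zero, hS.divNu_apply_zero, hi]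
      rcases hS.eq_zeroPlus_or_zeroMinus hQ with h | h
      · rw [h, show ptDiv S.zeroMinus S.zeroPlus = 0 from
          Finsupp.single_eq_of_ne hS.zeroPlus_ne_zeroMinus]
        exact (hS.phi_zeroPlus n).hasOrder (inv_ne_zero (hS.α_ne n))
      · rw [h, show ptDiv S.zeroMinus S.zeroMinus = 1 from Finsupp.single_eq_same]
        exact (hS.phi_zeroMinus n).hasOrder (neg_ne_zero.2 (hS.β_ne _))
    · have hm : ptDiv S.zeroMinus (.affine z₀ y₀) = 0 :=
        Finsupp.single_eq_of_ne (by simp [zeroMinus, hz])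
      rw [hi, hm, add_zero, sub_zero]
      exact hS.phi_hasOrder_finite n hz hQ
  | infPlus =>
    rw [divMu_apply_of_ne (by simp [muHat]), divNu_apply_of_ne (by simp [nuHat]),
      show ptDiv S.zeroMinus .infPlus = 0 from Finsupp.single_eq_of_ne (by simp [zeroMinus]),
      show ptDiv .infMinus .infPlus = 0 from Finsupp.single_eq_of_ne (by simp)]
    exact (hS.phi_infPlus n).hasOrder (hS.β_ne n)
  | infMinus =>
    rw [divMu_apply_of_ne (by simp [muHat]), divNu_apply_of_ne (by simp [nuHat]),
      show ptDiv S.zeroMinus .infMinus = 0 from Finsupp.single_eq_of_ne (by simp [zeroMinus]),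
      show ptDiv .infMinus .infMinus = 1 from Finsupp.single_eq_same]
    exact (hS.phi_infMinus n).hasOrder (neg_ne_zero.2 (inv_ne_zero (hS.α_ne _)))

theorem factor_hasOrder (hS : S.IsStationary E) (n : ℤ) {Q : CurvePt} (hQ : Q ∈ hyperCurve E) :
    HasOrder (fun ζ => (localParam E Q ζ).z + S.α n * S.phi (localParam E Q ζ) (n - 1))
      ((S.divMu n - S.divMu (n - 1) + (ptDiv S.zeroMinus - ptDiv .infPlus)) Q) := by
  simp only [Finsupp.sub_apply, Finsupp.add_apply]
  cases Q with
  | affine z₀ y₀ =>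
    have hi : ptDiv .infPlus (.affine z₀ y₀) = 0 := Finsupp.single_eq_of_ne (by simp)
    by_cases hz : z₀ = 0
    · subst hz
      rw [hS.divMu_apply_zero, hS.divMu_apply_zero, hi]
      rcases hS.eq_zeroPlus_or_zeroMinus hQ with h | h
      · rw [h, show ptDiv S.zeroMinus S.zeroPlus = 0 from
          Finsupp.single_eq_of_ne hS.zeroPlus_ne_zeroMinus]
        exact (hS.factor_zeroPlus n).hasOrder (div_ne_zero (hS.α_ne _) (hS.α_ne _))
      · rw [h, show ptDiv S.zeroMinus S.zeroMinus = 1 from Finsupp.single_eq_same]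
        exact (hS.factor_zeroMinus n).hasOrder (hS.γ_ne _)
    · have hm : ptDiv S.zeroMinus (.affine z₀ y₀) = 0 :=
        Finsupp.single_eq_of_ne (by simp [zeroMinus, hz])
      rw [hi, hm, sub_zero, add_zero]
      exact hS.factor_hasOrder_finite n hz hQ
  | infPlus =>
    rw [divMu_apply_of_ne (by simp [muHat]), divMu_apply_of_ne (by simp [muHat]),
      show ptDiv S.zeroMinus .infPlus = 0 from Finsupp.single_eq_of_ne (by simp [zeroMinus]),
      show ptDiv .infPlus .infPlus = 1 from Finsupp.single_eq_same]
    exact (hS.factor_infPlus n).hasOrder one_ne_zero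
  | infMinus =>
    rw [divMu_apply_of_ne (by simp [muHat]), divMu_apply_of_ne (by simp [muHat]),
      show ptDiv S.zeroMinus .infMinus = 0 from Finsupp.single_eq_of_ne (by simp [zeroMinus]),
      show ptDiv .infPlus .infMinus = 0 from Finsupp.single_eq_of_ne (by simp)]
    exact (hS.factor_infMinus n).hasOrder
      (mul_ne_zero (div_ne_zero (hS.α_ne _) (hS.α_ne _)) (hS.γ_ne _))

/-! ### The Baker-Akhiezer functions -/

theorem psi1_hasOrder (hS : S.IsStationary E) (n n₀ : ℤ) {Q : CurvePt} (hQ : Q ∈ hyperCurve E) :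
    HasOrder (fun ζ => S.psi1 (localParam E Q ζ) n n₀)
      ((S.divMu n - S.divMu n₀ + (n - n₀) • (ptDiv S.zeroMinus - ptDiv .infPlus)) Q) := by
  have h := HasOrder.latticeProd
    (d := fun k => S.divMu k Q + k * (ptDiv S.zeroMinus - ptDiv .infPlus) Q)
    (fun k => by
      have := hS.factor_hasOrder k hQ
      rw [Finsupp.add_apply, Finsupp.sub_apply] at this
      convert this using 1
      ring) n n₀
  have e : (S.divMu n - S.divMu n₀ + (n - n₀) • (ptDiv S.zeroMinus - ptDiv .infPlus)) Q
      = S.divMu n Q + n * (ptDiv S.zeroMinus - ptDiv .infPlus) Q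
        - (S.divMu n₀ Q + n₀ * (ptDiv S.zeroMinus - ptDiv .infPlus) Q) := by
    simp only [Finsupp.add_apply, Finsupp.sub_apply, Finsupp.smul_apply, smul_eq_mul]
    ring
  rw [e]
  exact h

/-- Near any point of the curve, `ψ₂ = φ ψ₁`. -/
theorem eventually_psi2_eq (hS : S.IsStationary E)
    (n n₀ : ℤ) {Q : CurvePt} (hQ : Q ∈ hyperCurve E) :
    ∀ᶠ ζ in 𝓝[≠] (0 : ℂ), S.psi2 (localParam E Q ζ) n n₀
      = S.psi1 (localParam E Q ζ) n n₀ * S.phi (localParam E Q ζ) n := by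
  have hne : ∀ k, ∀ᶠ ζ in 𝓝[≠] (0 : ℂ), S.phi (localParam E Q ζ) k ≠ 0 := fun k =>
    (hS.phi_hasOrder k hQ).eventually_ne_zero
  -- This is the Riccati equation divided by `φ⁻`; the quotients `φ/φ⁻` telescope and the remaining
  -- factors are those of `ψ₁`.
  have hfac : ∀ k, ∀ᶠ ζ in 𝓝[≠] (0 : ℂ),
      (localParam E Q ζ).z * S.β k * (S.phi (localParam E Q ζ) (k - 1))⁻¹ + 1
        = S.phi (localParam E Q ζ) k / S.phi (localParam E Q ζ) (k - 1)
          * ((localParam E Q ζ).z + S.α k * S.phi (localParam E Q ζ) (k - 1)) := by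
    intro k
    filter_upwards [hne (k - 1), hS.eventually_riccati hQ k] with ζ h1 h2
    field_simp
    linear_combination -h2
  filter_upwards [eventually_latticeProd_congr hfac n n₀, hne n₀,
    (Filter.eventually_all_finset (Finset.uIcc n₀ n)).2 fun k _ => hne k] with ζ h1 h2 h3
  rw [psi2, h1, latticeProd_mul,
    latticeProd_telescope (u := fun k => S.phi (localParam E Q ζ) k) h3, psi1]
  field_simp

theorem psi2_hasOrder (hS : S.IsStationary E) (n n₀ : ℤ) {Q : CurvePt} (hQ : Q ∈ hyperCurve E) :
    HasOrder (fun ζ => S.psi2 (localParam E Q ζ) n n₀)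
      ((S.divNu n - S.divMu n₀ + (n - n₀) • (ptDiv S.zeroMinus - ptDiv .infPlus)
        + ptDiv S.zeroMinus - ptDiv .infMinus) Q) := by
  have h := ((hS.psi1_hasOrder n n₀ hQ).mul (hS.phi_hasOrder n hQ)).congr
    (hS.eventually_psi2_eq n n₀ hQ)
  convert h using 1
  simp only [Finsupp.add_apply, Finsupp.sub_apply, Finsupp.smul_apply, smul_eq_mul]
  ring

theorem divMu_apply_of_notMem (hS : S.IsStationary E)
    (n : ℤ) {Q : CurvePt} (hQ : Q ∉ hyperCurve E) : S.divMu n Q = 0 :=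
  divMu_apply_of_ne fun _ hμ h => hQ (h ▸ hS.muHat_mem hμ)

theorem divNu_apply_of_notMem (hS : S.IsStationary E)
    (n : ℤ) {Q : CurvePt} (hQ : Q ∉ hyperCurve E) : S.divNu n Q = 0 :=
  divNu_apply_of_ne fun _ hν h => hQ (h ▸ hS.nuHat_mem hν)

theorem ptDiv_apply_of_notMem {P Q : CurvePt} (hP : P ∈ hyperCurve E) (hQ : Q ∉ hyperCurve E) :
    ptDiv P Q = 0 :=
  Finsupp.single_eq_of_ne fun h => hQ (h ▸ hP)

theorem psi1_hasDivisor (hS : S.IsStationary E) (n n₀ : ℤ) : HasDivisor E (fun P => S.psi1 P n n₀)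
    (S.divMu n - S.divMu n₀ + (n - n₀) • (ptDiv S.zeroMinus - ptDiv .infPlus)) := by
  refine ⟨fun Q hQ => ?_, fun Q hQ => ?_⟩
  · by_contra hQ'
    refine Finsupp.mem_support_iff.1 hQ ?_
    simp [hS.divMu_apply_of_notMem _ hQ', ptDiv_apply_of_notMem hS.zeroMinus_mem hQ',
      ptDiv_apply_of_notMem (P := .infPlus) trivial hQ']
  · obtain ⟨c, hc, h⟩ := hS.psi1_hasOrder n n₀ hQ
    exact ⟨h.meromorphicAt, h.meromorphicOrderAt_eq hc⟩

theorem psi2_hasDivisor (hS : S.IsStationary E) (n n₀ : ℤ) : HasDivisor E (fun P => S.psi2 P n n₀)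
    (S.divNu n - S.divMu n₀ + (n - n₀) • (ptDiv S.zeroMinus - ptDiv .infPlus)
      + ptDiv S.zeroMinus - ptDiv .infMinus) := by
  refine ⟨fun Q hQ => ?_, fun Q hQ => ?_⟩
  · by_contra hQ'
    refine Finsupp.mem_support_iff.1 hQ ?_
    simp [hS.divMu_apply_of_notMem _ hQ', hS.divNu_apply_of_notMem _ hQ',
      ptDiv_apply_of_notMem hS.zeroMinus_mem hQ',
      ptDiv_apply_of_notMem (P := .infPlus) trivial hQ',
      ptDiv_apply_of_notMem (P := .infMinus) trivial hQ']
  · obtain ⟨c, hc, h⟩ := hS.psi2_hasOrder n n₀ hQ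
    exact ⟨h.meromorphicAt, h.meromorphicOrderAt_eq hc⟩

/-! ### `ψ₂` near the four special points -/

theorem psi2_infPlus (hS : S.IsStationary E) (n n₀ : ℤ) : HasLeadingTerm
    (fun ζ => S.psi2 (localParam E .infPlus ζ) n n₀) (n₀ - n) (S.β n) := by
  have := ((hS.psi1_infPlus n n₀).mul (hS.phi_infPlus n)).congr
    (hS.eventually_psi2_eq n n₀ (Q := .infPlus) trivial)
  simpa using this

theorem psi2_infMinus (hS : S.IsStationary E) (n n₀ : ℤ) : HasLeadingTerm
    (fun ζ => S.psi2 (localParam E .infMinus ζ) n n₀) (-1)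
    (-(1 / S.α (n₀ + 1)) * S.Gam n n₀) := by
  have := ((hS.psi1_infMinus n n₀).mul (hS.phi_infMinus n)).congr
    (hS.eventually_psi2_eq n n₀ (Q := .infMinus) trivial)
  have hα := hS.α_ne (n + 1)
  rwa [zero_add, show S.α (n + 1) / S.α (n₀ + 1) * S.Gam n n₀ * -(S.α (n + 1))⁻¹
    = -(1 / S.α (n₀ + 1)) * S.Gam n n₀ by field_simp] at this

theorem psi2_zeroPlus (hS : S.IsStationary E) (n n₀ : ℤ) : HasLeadingTerm
    (fun ζ => S.psi2 (localParam E S.zeroPlus ζ) n n₀) 0 (1 / S.α n₀) := by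
  have := ((hS.psi1_zeroPlus n n₀).mul (hS.phi_zeroPlus n)).congr
    (hS.eventually_psi2_eq n n₀ hS.zeroPlus_mem)
  have hα := hS.α_ne n
  rwa [zero_add, show S.α n / S.α n₀ * (S.α n)⁻¹ = 1 / S.α n₀ by field_simp] at this

theorem psi2_zeroMinus (hS : S.IsStationary E) (n n₀ : ℤ) : HasLeadingTerm
    (fun ζ => S.psi2 (localParam E S.zeroMinus ζ) n n₀) (n + 1 - n₀)
    (-S.β (n + 1) * S.Gam n n₀) := by
  have := ((hS.psi1_zeroMinus n n₀).mul (hS.phi_zeroMinus n)).congr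
    (hS.eventually_psi2_eq n n₀ hS.zeroMinus_mem)
  convert this using 1 <;> ring

end IsStationary

end ALData

/-- A leading term at a point of the curve, as an estimate along `P → Q`. -/
theorem isBigO_towards {p : ℕ} {E : Fin (2 * p + 2) → ℂ} {Q : CurvePt} {f g : CurvePt → ℂ}
    {k : ℤ} {c : ℂ} {f₀ : ℂ → ℂ} (h : HasLeadingTerm f₀ k c)
    (hf : ∀ ζ, ζ ≠ 0 → f (localParam E Q ζ) = f₀ ζ - c * ζ ^ k)
    (hg : ∀ ζ, ζ ≠ 0 → g (localParam E Q ζ) = ζ ^ (k + 1)) : f =O[towards E Q] g := by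
  rw [towards, isBigO_map]
  refine h.sub_isBigO.congr' ?_ ?_
  · filter_upwards [eventually_ne_zero_punctured] with ζ h0 using (hf ζ h0).symm
  · filter_upwards [eventually_ne_zero_punctured] with ζ h0 using (hg ζ h0).symm

end

theorem mainTheorem8 (S : ALData) (p : ℕ) (E : Fin (2 * p + 2) → ℂ)
    -- standing assumptions on `α, β`, the constants and the index
    (hαβ : ∀ n, S.α n * S.β n ≠ 0 ∧ S.α n * S.β n ≠ 1)
    (hcm : S.cm ≠ 0) (hcp : S.cp ≠ 0) (hp : S.pm + S.pp = p + 1)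
    -- the coefficients and the stationary system, with `g_{p_+,+} = g_{p_-,-}`
    (hplus : S.RecursionPlus) (hminus : S.RecursionMinus)
    (hg : ∀ n, S.gp S.pp n = S.gm S.pm n) (hAL : S.StationaryAL)
    -- the nonsingular curve (`R` does not depend on the lattice point, so one of them suffices)
    (hE : ∀ z : ℂ, z ≠ 0 → S.R z 0 = (S.cp / (2 * z ^ S.pm)) ^ 2 * ∏ m, (z - E m))
    (hEinj : Function.Injective E)
    (n n₀ : ℤ) :
    -- the points that enter the divisors lie on the curve, and there are `p` of each kind
    ((S.zeroPlus ∈ hyperCurve E ∧ S.zeroMinus ∈ hyperCurve E) ∧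
      (S.mu n).card = p ∧ (∀ μ ∈ S.mu n, S.muHat n μ ∈ hyperCurve E) ∧
      (S.nu n).card = p ∧ (∀ ν ∈ S.nu n, S.nuHat n ν ∈ hyperCurve E)) ∧
    -- `φ` near `P_{∞+}`, `P_{∞-}`, `P_{0,+}`, `P_{0,-}`
    ((fun P => S.phi P n - (S.β n + S.β (n - 1) * S.γ n * P.z⁻¹))
        =O[towards E .infPlus] fun P => P.z⁻¹ ^ 2) ∧
    ((fun P => S.phi P n - (-(S.α (n + 1))⁻¹ * (P.z⁻¹)⁻¹
          + (S.α (n + 1) ^ 2)⁻¹ * S.α (n + 2) * S.γ (n + 1)))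
        =O[towards E .infMinus] fun P => P.z⁻¹) ∧
    ((fun P => S.phi P n - ((S.α n)⁻¹ - (S.α n ^ 2)⁻¹ * S.α (n - 1) * S.γ n * P.z))
        =O[towards E S.zeroPlus] fun P => P.z ^ 2) ∧
    ((fun P => S.phi P n - (-S.β (n + 1) * P.z - S.β (n + 2) * S.γ (n + 1) * P.z ^ 2))
        =O[towards E S.zeroMinus] fun P => P.z ^ 3) ∧
    -- `ψ₁` near the four points
    ((fun P => S.psi1 P n n₀ - P.z⁻¹ ^ (n₀ - n))
        =O[towards E .infPlus] fun P => P.z⁻¹ ^ (n₀ - n + 1)) ∧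
    ((fun P => S.psi1 P n n₀ - S.α (n + 1) / S.α (n₀ + 1) * S.Gam n n₀)
        =O[towards E .infMinus] fun P => P.z⁻¹) ∧
    ((fun P => S.psi1 P n n₀ - S.α n / S.α n₀)
        =O[towards E S.zeroPlus] fun P => P.z) ∧
    ((fun P => S.psi1 P n n₀ - P.z ^ (n - n₀) * S.Gam n n₀)
        =O[towards E S.zeroMinus] fun P => P.z ^ (n - n₀ + 1)) ∧
    -- `ψ₂` near the four points
    ((fun P => S.psi2 P n n₀ - S.β n * P.z⁻¹ ^ (n₀ - n))
        =O[towards E .infPlus] fun P => P.z⁻¹ ^ (n₀ - n + 1)) ∧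
    ((fun P => S.psi2 P n n₀ - -(1 / S.α (n₀ + 1)) * S.Gam n n₀ * (P.z⁻¹)⁻¹)
        =O[towards E .infMinus] fun _ => (1 : ℂ)) ∧
    ((fun P => S.psi2 P n n₀ - 1 / S.α n₀)
        =O[towards E S.zeroPlus] fun P => P.z) ∧
    ((fun P => S.psi2 P n n₀ - -S.β (n + 1) * S.Gam n n₀ * P.z ^ (n + 1 - n₀))
        =O[towards E S.zeroMinus] fun P => P.z ^ (n + 1 - n₀ + 1)) ∧
    -- the divisors of `ψ₁` and `ψ₂`
    HasDivisor E (fun P => S.psi1 P n n₀)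
      (S.divMu n - S.divMu n₀ + (n - n₀) • (ptDiv S.zeroMinus - ptDiv .infPlus)) ∧
    HasDivisor E (fun P => S.psi2 P n n₀)
      (S.divNu n - S.divMu n₀ + (n - n₀) • (ptDiv S.zeroMinus - ptDiv .infPlus)
        + ptDiv S.zeroMinus - ptDiv .infMinus) := by
  have hS : S.IsStationary E := ⟨hαβ, hcm, hcp, hp, hplus, hminus, hg, hAL, hE, hEinj⟩
  have zp := localParam_infPlus_z (E := E)
  have zm := localParam_infMinus_z (E := E)
  have z0p := hS.localParam_zeroPlus_z
  have z0m := hS.localParam_zeroMinus_z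
  refine ⟨⟨⟨hS.zeroPlus_mem, hS.zeroMinus_mem⟩, hS.card_mu n,
    fun μ hμ => hS.muHat_mem (isRoot_of_mem_roots hμ), hS.card_nu n,
    fun ν hν => hS.nuHat_mem (isRoot_of_mem_roots hν)⟩, ?_, ?_, ?_, ?_, ?_, ?_, ?_, ?_, ?_, ?_, ?_,
    ?_, hS.psi1_hasDivisor n n₀, hS.psi2_hasDivisor n n₀⟩
  · refine isBigO_towards (hS.phi_sub_infPlus n) (fun ζ _ => ?_) fun ζ _ => ?_
    · rw [zp, inv_inv, zpow_one]; ring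
    · rw [zp, inv_inv]; norm_cast
  · refine isBigO_towards (hS.phi_sub_infMinus n) (fun ζ _ => ?_) fun ζ _ => ?_
    · rw [zm, inv_inv, zpow_zero]; ring
    · rw [zm, inv_inv, zero_add, zpow_one]
  · refine isBigO_towards (hS.phi_sub_zeroPlus n) (fun ζ _ => ?_) fun ζ _ => ?_
    · rw [z0p, zpow_one]; ring
    · rw [z0p]; norm_cast
  · refine isBigO_towards (hS.phi_sub_zeroMinus n) (fun ζ _ => ?_) fun ζ _ => ?_
    · rw [z0m, show ζ ^ (2 : ℤ) = ζ ^ 2 by norm_cast]; ring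
    · rw [z0m]; norm_cast
  · refine isBigO_towards (hS.psi1_infPlus n n₀) (fun ζ _ => ?_) fun ζ _ => ?_
    · rw [zp, inv_inv, one_mul]
    · rw [zp, inv_inv]
  · refine isBigO_towards (hS.psi1_infMinus n n₀) (fun ζ _ => ?_) fun ζ _ => ?_
    · rw [zpow_zero, mul_one]
    · rw [zm, inv_inv, zero_add, zpow_one]
  · refine isBigO_towards (hS.psi1_zeroPlus n n₀) (fun ζ _ => ?_) fun ζ _ => ?_
    · rw [zpow_zero, mul_one]
    · rw [z0p, zero_add, zpow_one]
  · refine isBigO_towards (hS.psi1_zeroMinus n n₀) (fun ζ _ => ?_) fun ζ _ => ?_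
    · rw [z0m, mul_comm]
    · rw [z0m]
  · refine isBigO_towards (hS.psi2_infPlus n n₀) (fun ζ _ => ?_) fun ζ _ => ?_
    · rw [zp, inv_inv]
    · rw [zp, inv_inv]
  · refine isBigO_towards (hS.psi2_infMinus n n₀) (fun ζ _ => ?_) fun ζ _ => ?_
    · rw [zm, inv_inv, zpow_neg_one]
    · rw [neg_add_cancel, zpow_zero]
  · refine isBigO_towards (hS.psi2_zeroPlus n n₀) (fun ζ _ => ?_) fun ζ _ => ?_
    · rw [zpow_zero, mul_one]
    · rw [z0p, zero_add, zpow_one]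
  · refine isBigO_towards (hS.psi2_zeroMinus n n₀) (fun ζ _ => ?_) fun ζ _ => ?_
    · rw [z0m]
    · rw [z0m]
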